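/- Let $n,w\ge 0$ be integers and $1/2<p<1$, $0<\lambda\le 1$, $0<\delta\le 1/2$. Let $A$ be a unitary operator on $n$ qubits, $A|0^n\rangle=\sum_{x\in\{0,1\}^n}\alpha_x|x\rangle$, and let $f:\{0,1\}^n\to\{0,1\}$; a string $x$ is called good if $f(x)=1$. A bounded-error oracle $\hat{\mathcal O}_p$ for $f$ is a unitary operator on $n+w+1$ qubits (the case $w=0$ is the oracle without workspace) such that for every $x$ $$\hat{\mathcal O}_p|x\rangle|0^w\rangle|0\rangle=|x\rangle\big(|\phi_{x,0}\rangle|0\rangle+|\phi_{x,1}\rangle|1\rangle\big),\qquad \big\||\phi_{x,f(x)}\rangle\big\|^2\ge p .$$ There is an absolute constant $C>0$ such that for all $n,w,p,\lambda,\delta$ as above there is a quantum algorithm, depending only on $n,w,p,\lambda,\delta$, that has black-box access to $A$, $A^\dagger$, $\hat{\mathcal O}_p$, $\hat{\mathcal O}_p^\dagger$, may apply any further unitary operators that do not depend on these black boxes, may measure single qubits in the standard basis and choose its later steps according to the results, and * acts on $n+a$ qubits, all initially $|0\rangle$, where $a\le C\,(w+1)\,\frac{2p}{(p-1/2)^2}\log\frac1{\lambda\delta}$,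 * makes in the worst case at most $C\,\frac{p}{(p-1/2)^2\sqrt\lambda}\log\frac1{\lambda\delta}$ queries to $\hat{\mathcal O}_p$ or $\hat{\mathcal O}_p^\dagger$, and that has the following two properties for all $f$, $A$ and every bounded-error oracle $\hat{\mathcal O}_p$ for $f$. 1. If the probability $\sum_{x:\,f(x)=1}|\alpha_x|^2$ of obtaining a good string on measuring $A|0^n\rangle$ is at least $\lambda$ (in particular, if some good $x$ has $|\alpha_x|^2\ge\lambda$), then the algorithm outputs a good string with probability at least $1-\delta$. 2. If $A|0^n\rangle$ contains no good string, i.e. $\alpha_x=0$ for every $x$ with $f(x)=1$, then the algorithm outputs "No Solution" with probability at least $1-\delta$. -/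

import Mathlib

/-- Computational basis states (bit strings) of qubits labelled by `ι`. -/
abbrev Bits (ι : Type) : Type := ι → Bool

/-- The all-zero bit string. -/
def zeroBits (ι : Type) : Bits ι := fun _ => false

/-- Unitary operators on the qubits labelled by `ι`. -/
abbrev QUnitary (ι : Type) [Fintype ι] [DecidableEq ι] : Type :=
  ↥(Matrix.unitaryGroup (Bits ι) ℂ)

/-- The wires on which a marking oracle acts: `n` input qubits, `w` workspace qubits and one
flag qubit. -/
abbrev OracleWire (n w : ℕ) : Type := Fin n ⊕ (Fin w ⊕ Unit)

/-- The bit string of the oracle wires with input `x`, workspace `g` and flag `b`. -/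
def oracleBits {n w : ℕ} (x : Bits (Fin n)) (g : Bits (Fin w)) (b : Bool) :
    Bits (OracleWire n w) :=
  Sum.elim x (Sum.elim g (fun _ => b))

/-- `O` is a bounded-error marking oracle for the set of good strings `{x | f x = true}`:
`O |x⟩|0^w⟩|0⟩ = |x⟩ (|φ_{x,0}⟩|0⟩ + |φ_{x,1}⟩|1⟩)` with `‖φ_{x, f x}‖² ≥ p`, for every `x`.
Nothing is assumed about the other inputs. -/
def IsBiasedOracle {n w : ℕ} (f : Bits (Fin n) → Bool) (p : ℝ)
    (O : QUnitary (OracleWire n w)) : Prop :=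
  ∀ x : Bits (Fin n),
    (∀ (y : Bits (Fin n)) (g : Bits (Fin w)) (b : Bool), y ≠ x →
      (O : Matrix (Bits (OracleWire n w)) (Bits (OracleWire n w)) ℂ)
        (oracleBits y g b) (oracleBits x (zeroBits (Fin w)) false) = 0) ∧
    p ≤ ∑ g : Bits (Fin w),
      ‖(O : Matrix (Bits (OracleWire n w)) (Bits (OracleWire n w)) ℂ)
        (oracleBits x g (f x)) (oracleBits x (zeroBits (Fin w)) false)‖ ^ 2

/-- Amplitude `α_x` of `|x⟩` in the state `A |0^n⟩`. -/
def amplitude {n : ℕ} (A : QUnitary (Fin n)) (x : Bits (Fin n)) : ℂ :=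
  (A : Matrix (Bits (Fin n)) (Bits (Fin n)) ℂ) x (zeroBits (Fin n))

/-- The probability that measuring `A |0^n⟩` gives a good string. -/
noncomputable def goodProb {n : ℕ} (f : Bits (Fin n) → Bool) (A : QUnitary (Fin n)) : ℝ :=
  ∑ x : Bits (Fin n), if f x = true then ‖amplitude A x‖ ^ 2 else 0

/-- State vectors (possibly unnormalised) of `N` qubits. -/
abbrev QState (N : ℕ) : Type := Bits (Fin N) → ℂ

/-- The state `|0^N⟩`. -/
def initState (N : ℕ) : QState N := Pi.single (zeroBits (Fin N)) 1

/-- The operator `U` applied to those qubits of an `N`-qubit state that are selected by `e`, the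
identity being applied to the other ones. -/
noncomputable def applyOn {ι : Type} [Fintype ι] [DecidableEq ι] {N : ℕ} (e : ι ↪ Fin N)
    (U : QUnitary ι) (ψ : QState N) : QState N :=
  fun z => ∑ u : Bits ι,
    (U : Matrix (Bits ι) (Bits ι) ℂ) (fun j => z (e j)) u * ψ (Function.extend e u z)

/-- The unnormalised state after qubit `i` was measured with result `b`. -/
def project {N : ℕ} (i : Fin N) (b : Bool) (ψ : QState N) : QState N :=
  fun z => if z i = b then ψ z else 0

/-- Quantum algorithms on `N` qubits with black-box access to an `n`-qubit operator `A` and to a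
marking oracle with `w` workspace qubits. The algorithm applies fixed unitary operators (which
depend on neither black box), `A`, `A†`, the oracle and its inverse, and single-qubit measurements
in the standard basis, whose results may control what follows. It halts with an output: `some y`
for a bit string `y`, or `none` for "No Solution". -/
inductive QAlg (n w N : ℕ) : Type where
  | halt (out : Option (Bits (Fin n))) : QAlg n w N
  | gate (U : QUnitary (Fin N)) (next : QAlg n w N) : QAlg n w N
  | prep (e : Fin n ↪ Fin N) (next : QAlg n w N) : QAlg n w N
  | prepInv (e : Fin n ↪ Fin N) (next : QAlg n w N) : QAlg n w N
  | query (e : OracleWire n w ↪ Fin N) (next : QAlg n w N) : QAlg n w N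
  | queryInv (e : OracleWire n w ↪ Fin N) (next : QAlg n w N) : QAlg n w N
  | measure (i : Fin N) (next : Bool → QAlg n w N) : QAlg n w N

namespace QAlg

variable {n w N : ℕ}

/-- The worst-case number of calls to the marking oracle or its inverse. -/
def queries : QAlg n w N → ℕ
  | halt _ => 0
  | gate _ next => next.queries
  | prep _ next => next.queries
  | prepInv _ next => next.queries
  | query _ next => next.queries + 1
  | queryInv _ next => next.queries + 1
  | measure _ next => max (next false).queries (next true).queries

/-- The probability that the algorithm, started in the state `ψ`, halts with the given output. -/
noncomputable def outProbFrom (A : QUnitary (Fin n)) (O : QUnitary (OracleWire n w)) :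
    QAlg n w N → QState N → Option (Bits (Fin n)) → ℝ
  | halt r, ψ, out => if r = out then ∑ z : Bits (Fin N), ‖ψ z‖ ^ 2 else 0
  | gate U next, ψ, out => outProbFrom A O next (U.val.mulVec ψ) out
  | prep e next, ψ, out => outProbFrom A O next (applyOn e A ψ) out
  | prepInv e next, ψ, out => outProbFrom A O next (applyOn e A⁻¹ ψ) out
  | query e next, ψ, out => outProbFrom A O next (applyOn e O ψ) out
  | queryInv e next, ψ, out => outProbFrom A O next (applyOn e O⁻¹ ψ) out
  | measure i next, ψ, out =>
      outProbFrom A O (next false) (project i false ψ) out +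
        outProbFrom A O (next true) (project i true ψ) out

/-- The probability of the given output when all qubits start in `|0⟩`. -/
noncomputable def outProb (alg : QAlg n w N) (A : QUnitary (Fin n))
    (O : QUnitary (OracleWire n w)) (out : Option (Bits (Fin n))) : ℝ :=
  alg.outProbFrom A O (initState N) out

/-- The probability that the output is a good bit string. -/
noncomputable def goodOutProb (alg : QAlg n w N) (f : Bits (Fin n) → Bool)
    (A : QUnitary (Fin n)) (O : QUnitary (OracleWire n w)) : ℝ :=
  ∑ y : Bits (Fin n), if f y = true then alg.outProb A O (some y) else 0

end QAlg

/-! A majority vote over `2 * v` oracle calls, each on its own cleared register, errs on any input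
with probability at most `(4p(1-p))^v` (`sum_minority_le`). If the vote is computed coherently,
recorded in a tag and uncomputed, the amplitude of `|x⟩` on cleared registers under the new tag is
the old amplitude times the real number `q(x)`, the probability of a positive vote
(`run_checkCircuit_clear`). Everything else is left as garbage outside this sector. Each check uses
fresh tags, so the garbage never interferes with later checks, although the oracle is unspecified on
uncleared registers.

Stages of amplification and checking thus reduce to the scalar recursion `checkedAmp`
(`run_stageCircuit`): amplification multiplies by `3 - 4s`, where `s` is the current total weight,
and the next check multiplies by `q(x)`. Round `j` takes `2(j+1)μ` votes, so its error is at most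
`100^(-(j+1))`. These errors are summable, while the circuit length triples in each round, so the
linearly growing votes cost only a constant factor (`cost_stageCircuit_le`). The bad weight stays
below `2^(-j)/10000`, and the good weight grows by nearly `9` per round until some round `k ≤ K` has
good weight at least `1/16` (`exists_checkedWeight_true_ge`), where `3^K` is of order `1/√λ`. This
round is unknown, so an attempt runs all of them; the geometric sum of costs is of order `μ/√λ`, and
a bad candidate appears with probability at most `1/5000`.

Repeating attempts and verifying each candidate to precision `δ` would risk a second factor
`log(1/δ)`. Instead, a walk verifies its candidate with constant error per step, moving up or down,
and makes a new attempt at height `0`. If good inputs are likely enough, the potential `2^(-h)` for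
a good and `2^h` for a bad candidate at height `h` shrinks by `98/100` per step in expectation
(`loss_walk_le_of_good`). If there are none, the mean of `2^h` stays at most `3`
(`loss_walk_le_of_no_good`). A threshold `H` of order `log(1/δ)` and `100 H` steps therefore
suffice. -/

/-! ### Operators on selected wires as unitary matrices -/

section Embedding

variable {ι : Type} {N : ℕ}

theorem extend_comp_embedding (e : ι ↪ Fin N) (u : Bits ι) (z : Bits (Fin N)) :
    (fun j => Function.extend e u z (e j)) = u :=
  funext fun j => e.injective.extend_apply u z j

theorem extend_extend (e : ι ↪ Fin N) (u v : Bits ι) (z : Bits (Fin N)) :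
    Function.extend e v (Function.extend e u z) = Function.extend e v z := by
  funext i
  by_cases h : ∃ j, e j = i
  · obtain ⟨j, rfl⟩ := h
    simp [e.injective.extend_apply]
  · simp [Function.extend_apply' _ _ _ h]

theorem extend_self_comp (e : ι ↪ Fin N) (z : Bits (Fin N)) :
    Function.extend e (fun j => z (e j)) z = z := by
  funext i
  by_cases h : ∃ j, e j = i
  · obtain ⟨j, rfl⟩ := h
    simp [e.injective.extend_apply]
  · simp [Function.extend_apply' _ _ _ h]

theorem extend_comp_eq_comm (e : ι ↪ Fin N) (z z' : Bits (Fin N)) :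
    Function.extend e (fun j => z' (e j)) z = z' ↔
      Function.extend e (fun j => z (e j)) z' = z := by
  constructor
  · intro h
    rw [← h, extend_extend, extend_self_comp]
  · intro h
    rw [← h, extend_extend, extend_self_comp]

/-- The matrix of the operator `M` acting on the wires selected by `e`. -/
noncomputable def embedMatrix (e : ι ↪ Fin N) (M : Matrix (Bits ι) (Bits ι) ℂ) :
    Matrix (Bits (Fin N)) (Bits (Fin N)) ℂ :=
  Matrix.of fun z z' => if Function.extend e (fun j => z' (e j)) z = z' then
    M (fun j => z (e j)) (fun j => z' (e j)) else 0

theorem embedMatrix_star (e : ι ↪ Fin N) (M : Matrix (Bits ι) (Bits ι) ℂ) :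
    embedMatrix e (star M) = star (embedMatrix e M) := by
  ext z z'
  simp only [embedMatrix, Matrix.star_apply, Matrix.of_apply, extend_comp_eq_comm e z z']
  split_ifs <;> simp

variable [Fintype ι] [DecidableEq ι]

theorem embedMatrix_mulVec (e : ι ↪ Fin N) (M : Matrix (Bits ι) (Bits ι) ℂ) (ψ : QState N)
    (z : Bits (Fin N)) :
    (embedMatrix e M).mulVec ψ z =
      ∑ u : Bits ι, M (fun j => z (e j)) u * ψ (Function.extend e u z) := by
  simp only [Matrix.mulVec, dotProduct, embedMatrix, Matrix.of_apply, ite_mul, zero_mul]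
  rw [← Finset.sum_filter]
  symm
  refine Finset.sum_bij' (fun u _ => Function.extend e u z) (fun z' _ j => z' (e j)) ?_ ?_ ?_ ?_ ?_
  · intro u _
    simp [extend_comp_embedding]
  · intro z' _
    simp
  · intro u _
    exact extend_comp_embedding e u z
  · intro z' h
    simpa using h
  · intro u _
    rw [extend_comp_embedding]

theorem embedMatrix_one (e : ι ↪ Fin N) : embedMatrix e (1 : Matrix (Bits ι) (Bits ι) ℂ) = 1 := by
  apply Matrix.mulVec_injective
  funext ψ z
  rw [embedMatrix_mulVec, Matrix.one_mulVec]
  simp [Matrix.one_apply, extend_self_comp]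

theorem embedMatrix_mul (e : ι ↪ Fin N) (L M : Matrix (Bits ι) (Bits ι) ℂ) :
    embedMatrix e (L * M) = embedMatrix e L * embedMatrix e M := by
  apply Matrix.mulVec_injective
  funext ψ z
  rw [← Matrix.mulVec_mulVec, embedMatrix_mulVec, embedMatrix_mulVec]
  simp only [embedMatrix_mulVec, extend_comp_embedding, extend_extend, Matrix.mul_apply,
    Finset.sum_mul, Finset.mul_sum]
  rw [Finset.sum_comm]
  simp only [mul_assoc]

/-- The unitary operator `U` acting on the wires selected by `e`. -/
noncomputable def embedUnitary (e : ι ↪ Fin N) : QUnitary ι →* QUnitary (Fin N) where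
  toFun U := ⟨embedMatrix e U.val, by
    rw [Matrix.mem_unitaryGroup_iff, ← embedMatrix_star, ← embedMatrix_mul,
      Matrix.mem_unitaryGroup_iff.mp U.2, embedMatrix_one]⟩
  map_one' := Subtype.ext (embedMatrix_one e)
  map_mul' U V := Subtype.ext (embedMatrix_mul e U.val V.val)

/-- Places every black-box call in the unitary group on all qubits, so that inverses, composition
and norm preservation come from the group structure. -/
theorem applyOn_eq_mulVec (e : ι ↪ Fin N) (U : QUnitary ι) (ψ : QState N) :
    applyOn e U ψ = (embedUnitary e U).val.mulVec ψ :=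
  funext fun z => (embedMatrix_mulVec e U.val ψ z).symm

end Embedding

/-! ### Sign flips, permutations of basis states, and norms -/

section Gates

variable {N : ℕ}

/-- The unitary operator that flips the sign of the basis states that satisfy `P`. -/
def signGate (P : Bits (Fin N) → Bool) : QUnitary (Fin N) :=
  ⟨Matrix.diagonal fun z => if P z then -1 else 1, by
    rw [Matrix.mem_unitaryGroup_iff, Matrix.star_eq_conjTranspose, Matrix.diagonal_conjTranspose,
      Matrix.diagonal_mul_diagonal, ← Matrix.diagonal_one]
    congr 1
    funext z
    by_cases h : P z <;> simp [h]⟩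

theorem signGate_mulVec (P : Bits (Fin N) → Bool) (ψ : QState N) (z : Bits (Fin N)) :
    (signGate P).val.mulVec ψ z = if P z then -ψ z else ψ z := by
  simp only [signGate, Matrix.mulVec_diagonal]
  split_ifs <;> simp

/-- The unitary operator that permutes the basis states by an involution. -/
def involutionGate (π : Bits (Fin N) → Bits (Fin N)) (h : Function.Involutive π) :
    QUnitary (Fin N) :=
  ⟨Matrix.of fun z z' => if π z = z' then 1 else 0, by
    rw [Matrix.mem_unitaryGroup_iff]
    ext z z'
    simp [Matrix.mul_apply, Matrix.star_apply, Matrix.one_apply, h.injective.eq_iff, eq_comm]⟩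

theorem involutionGate_mulVec (π : Bits (Fin N) → Bits (Fin N)) (h : Function.Involutive π)
    (ψ : QState N) (z : Bits (Fin N)) :
    (involutionGate π h).val.mulVec ψ z = ψ (π z) := by
  simp [involutionGate, Matrix.mulVec, dotProduct]

theorem unitary_inv_mulVec (U : QUnitary (Fin N)) (ψ : QState N) (z : Bits (Fin N)) :
    (U⁻¹).val.mulVec ψ z = ∑ z', star (U.val.mulVec (Pi.single z 1) z') * ψ z' := by
  have : (U⁻¹).val = star U.val := rfl
  rw [this]
  simp only [Matrix.mulVec_single_one, Matrix.col_apply]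
  simp [Matrix.mulVec, dotProduct, Matrix.star_apply]

theorem unitary_sum_norm_sq (U : QUnitary (Fin N)) (z : Bits (Fin N)) :
    ∑ z', ‖U.val.mulVec (Pi.single z 1) z'‖ ^ 2 = 1 := by
  have h := unitary_inv_mulVec U (U.val.mulVec (Pi.single z 1)) z
  rw [Matrix.mulVec_mulVec] at h
  have h1 : (U⁻¹).val * U.val = 1 := congrArg Subtype.val (inv_mul_cancel U)
  rw [h1, Matrix.one_mulVec, Pi.single_eq_same] at h
  have h2 : ((∑ z', ‖U.val.mulVec (Pi.single z 1) z'‖ ^ 2 : ℝ) : ℂ) = 1 := by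
    refine Eq.trans ?_ h.symm
    push_cast
    refine Finset.sum_congr rfl fun z' _ => ?_
    rw [mul_comm]
    exact (RCLike.mul_conj (K := ℂ) _).symm
  exact_mod_cast h2

end Gates

/-! ### Measurement-free circuits and their inverses -/

/-- One unitary step of an algorithm. -/
inductive QOp (n w N : ℕ) : Type where
  | gate (U : QUnitary (Fin N)) : QOp n w N
  | prep (e : Fin n ↪ Fin N) : QOp n w N
  | prepInv (e : Fin n ↪ Fin N) : QOp n w N
  | query (e : OracleWire n w ↪ Fin N) : QOp n w N
  | queryInv (e : OracleWire n w ↪ Fin N) : QOp n w N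

namespace QOp

variable {n w N : ℕ} (A : QUnitary (Fin n)) (O : QUnitary (OracleWire n w))

/-- The operator performed by a step. -/
noncomputable def unitary : QOp n w N → QUnitary (Fin N)
  | gate U => U
  | prep e => embedUnitary e A
  | prepInv e => embedUnitary e A⁻¹
  | query e => embedUnitary e O
  | queryInv e => embedUnitary e O⁻¹

/-- The inverse step. -/
noncomputable def inv : QOp n w N → QOp n w N
  | gate U => gate U⁻¹
  | prep e => prepInv e
  | prepInv e => prep e
  | query e => queryInv e
  | queryInv e => query e

theorem unitary_inv (s : QOp n w N) : s.inv.unitary A O = (s.unitary A O)⁻¹ := by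
  cases s <;> simp [inv, unitary]

/-- The number of oracle calls of a step. -/
def cost : QOp n w N → ℕ
  | query _ => 1
  | queryInv _ => 1
  | _ => 0

theorem cost_inv (s : QOp n w N) : s.inv.cost = s.cost := by
  cases s <;> rfl

/-- Perform a step, then continue. -/
def andThen (s : QOp n w N) (next : QAlg n w N) : QAlg n w N :=
  match s with
  | gate U => .gate U next
  | prep e => .prep e next
  | prepInv e => .prepInv e next
  | query e => .query e next
  | queryInv e => .queryInv e next

end QOp

/-- Sequences of unitary steps, first step first. -/
abbrev QCircuit (n w N : ℕ) : Type := List (QOp n w N)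

namespace QCircuit

variable {n w N : ℕ} (A : QUnitary (Fin n)) (O : QUnitary (OracleWire n w))

/-- The operator performed by a circuit. -/
noncomputable def unitary : QCircuit n w N → QUnitary (Fin N)
  | [] => 1
  | s :: c => unitary c * s.unitary A O

/-- The state reached from `ψ`. -/
noncomputable def run (c : QCircuit n w N) (ψ : QState N) : QState N :=
  (unitary A O c).val.mulVec ψ

/-- The inverse circuit. -/
noncomputable def inv (c : QCircuit n w N) : QCircuit n w N := (c.map QOp.inv).reverse

/-- The number of oracle calls of a circuit. -/
def cost (c : QCircuit n w N) : ℕ := (c.map QOp.cost).sum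

theorem unitary_append (c d : QCircuit n w N) :
    unitary A O (c ++ d) = unitary A O d * unitary A O c := by
  induction c with
  | nil => simp [unitary]
  | cons s c ih => simp [unitary, ih, mul_assoc]

theorem unitary_inv (c : QCircuit n w N) : unitary A O (inv c) = (unitary A O c)⁻¹ := by
  induction c with
  | nil => simp [unitary, inv]
  | cons s c ih =>
    have h : inv (s :: c) = inv c ++ [s.inv] := by simp [inv]
    rw [h, unitary_append, ih]
    simp [unitary, QOp.unitary_inv]

theorem cost_append (c d : QCircuit n w N) : cost (c ++ d) = cost c + cost d := by
  simp [cost]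

theorem cost_inv (c : QCircuit n w N) : cost (inv c) = cost c := by
  simp [cost, inv, List.sum_reverse, Function.comp_def, QOp.cost_inv]

theorem run_nil (ψ : QState N) : run A O ([] : QCircuit n w N) ψ = ψ := by
  simp [run, unitary]

theorem run_append (c d : QCircuit n w N) (ψ : QState N) :
    run A O (c ++ d) ψ = run A O d (run A O c ψ) := by
  simp [run, unitary_append]

theorem run_singleton (s : QOp n w N) (ψ : QState N) :
    run A O [s] ψ = (s.unitary A O).val.mulVec ψ := by
  simp [run, unitary]

theorem run_cons (s : QOp n w N) (c : QCircuit n w N) (ψ : QState N) :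
    run A O (s :: c) ψ = run A O c ((s.unitary A O).val.mulVec ψ) := by
  simp [run, unitary]

/-- A coordinate of `U⁻¹ψ` is the inner product of `U|z⟩` with `ψ`. Uncomputation can thus be
evaluated from the forward circuit on cleared basis states, the only ones on which the oracle is
specified. -/
theorem run_inv_apply (c : QCircuit n w N) (ψ : QState N) (z : Bits (Fin N)) :
    run A O (inv c) ψ z = ∑ z', star (run A O c (Pi.single z 1) z') * ψ z' := by
  rw [run, unitary_inv, unitary_inv_mulVec]
  rfl

theorem sum_norm_sq_run_init (c : QCircuit n w N) :
    ∑ z, ‖run A O c (initState N) z‖ ^ 2 = 1 :=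
  unitary_sum_norm_sq _ _

/-- Run the circuit, then continue. -/
def andThen (c : QCircuit n w N) (next : QAlg n w N) : QAlg n w N :=
  c.foldr QOp.andThen next

theorem queries_andThen (c : QCircuit n w N) (next : QAlg n w N) :
    (andThen c next).queries = cost c + next.queries := by
  induction c with
  | nil => simp [andThen, cost]
  | cons s c ih =>
    have h : andThen (s :: c) next = s.andThen (andThen c next) := rfl
    have h' : cost (s :: c) = s.cost + cost c := by simp [cost]
    rw [h, h']
    cases s <;> simp [QOp.andThen, QAlg.queries, QOp.cost, ih] <;> omega

theorem outProbFrom_andThen (c : QCircuit n w N) (next : QAlg n w N) (ψ : QState N)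
    (out : Option (Bits (Fin n))) :
    (andThen c next).outProbFrom A O ψ out = next.outProbFrom A O (run A O c ψ) out := by
  induction c generalizing ψ with
  | nil => simp [andThen, run_nil]
  | cons s c ih =>
    have h : andThen (s :: c) next = s.andThen (andThen c next) := rfl
    rw [h, run_cons, ← ih]
    cases s <;> simp [QOp.andThen, QAlg.outProbFrom, QOp.unitary, applyOn_eq_mulVec]

end QCircuit

/-! ### Coordinates: input, oracle registers, tag -/

/-- The wires of a search circuit: `n` input qubits, `r` copies of the workspace and flag of the
oracle, and `m` tag qubits. -/
abbrev SearchWire (n w r m : ℕ) : Type := Fin n ⊕ ((Fin r × (Fin w ⊕ Unit)) ⊕ Fin m)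

section Layout

variable {n w r m N : ℕ} (σ : SearchWire n w r m ≃ Fin N)

/-- The basis state with input `x`, oracle registers `g` and tag `t`. -/
def basisState (x : Bits (Fin n)) (g : Fin r → Bits (Fin w ⊕ Unit)) (t : Bits (Fin m)) :
    Bits (Fin N) :=
  fun i => Sum.elim x (Sum.elim (fun cj => g cj.1 cj.2) t) (σ.symm i)

/-- The input part of a basis state. -/
def inputPart (z : Bits (Fin N)) : Bits (Fin n) := fun i => z (σ (Sum.inl i))

/-- The oracle registers of a basis state. -/
def registerPart (z : Bits (Fin N)) : Fin r → Bits (Fin w ⊕ Unit) :=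
  fun c j => z (σ (Sum.inr (Sum.inl (c, j))))

/-- The tag of a basis state. -/
def tagPart (z : Bits (Fin N)) : Bits (Fin m) := fun i => z (σ (Sum.inr (Sum.inr i)))

variable (x : Bits (Fin n)) (g : Fin r → Bits (Fin w ⊕ Unit)) (t : Bits (Fin m))

@[simp] theorem inputPart_basisState : inputPart σ (basisState σ x g t) = x := by
  funext i; simp [inputPart, basisState]

@[simp] theorem registerPart_basisState : registerPart σ (basisState σ x g t) = g := by
  funext c j; simp [registerPart, basisState]

@[simp] theorem tagPart_basisState : tagPart σ (basisState σ x g t) = t := by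
  funext i; simp [tagPart, basisState]

@[simp] theorem basisState_parts (z : Bits (Fin N)) :
    basisState σ (inputPart σ z) (registerPart σ z) (tagPart σ z) = z := by
  funext i
  obtain ⟨s, rfl⟩ := σ.surjective i
  rcases s with i | ⟨c, j⟩ | i <;> simp [basisState, inputPart, registerPart, tagPart]

/-- Basis states as triples. -/
def basisEquiv :
    Bits (Fin n) × (Fin r → Bits (Fin w ⊕ Unit)) × Bits (Fin m) ≃ Bits (Fin N) where
  toFun c := basisState σ c.1 c.2.1 c.2.2
  invFun z := (inputPart σ z, registerPart σ z, tagPart σ z)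
  left_inv c := by simp
  right_inv z := by simp

theorem sum_basis {M : Type*} [AddCommMonoid M] (F : Bits (Fin N) → M) :
    ∑ z, F z = ∑ x, ∑ g, ∑ t, F (basisState σ x g t) := by
  rw [← (basisEquiv σ).sum_comp F, Fintype.sum_prod_type]
  refine Finset.sum_congr rfl fun x _ => ?_
  rw [Fintype.sum_prod_type]
  rfl

theorem basisState_inj {x' : Bits (Fin n)} {g' : Fin r → Bits (Fin w ⊕ Unit)}
    {t' : Bits (Fin m)} :
    basisState σ x g t = basisState σ x' g' t' ↔ x = x' ∧ g = g' ∧ t = t' := by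
  constructor
  · intro h
    refine ⟨?_, ?_, ?_⟩
    · simpa using congrArg (inputPart σ) h
    · simpa using congrArg (registerPart σ) h
    · simpa using congrArg (tagPart σ) h
  · rintro ⟨rfl, rfl, rfl⟩
    rfl

/-- Cleared oracle registers. -/
def clearRegs : Fin r → Bits (Fin w ⊕ Unit) := fun _ => zeroBits _

theorem basisState_zero :
    basisState σ (zeroBits _) clearRegs (zeroBits _) = zeroBits (Fin N) := by
  funext i
  obtain ⟨s, rfl⟩ := σ.surjective i
  rcases s with i | ⟨c, j⟩ | i <;> simp [basisState, zeroBits, clearRegs]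

/-- The input wires. -/
def inputEmb : Fin n ↪ Fin N :=
  ⟨fun i => σ (Sum.inl i), fun i j h => by simpa using h⟩

/-- The wires of the oracle that uses register `c`. -/
def oracleEmb (c : Fin r) : OracleWire n w ↪ Fin N :=
  ⟨fun s => σ (Sum.elim Sum.inl (fun j => Sum.inr (Sum.inl (c, j))) s), fun s s' h => by
    rcases s with i | j <;> rcases s' with i' | j' <;> simp_all⟩

theorem basisState_inputEmb : (fun j => basisState σ x g t (inputEmb σ j)) = x := by
  funext j
  change Sum.elim x _ (σ.symm (σ (Sum.inl j))) = x j
  simp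

theorem basisState_oracleEmb (c : Fin r) :
    (fun j => basisState σ x g t (oracleEmb σ c j)) = Sum.elim x (g c) := by
  funext j
  change Sum.elim x _ (σ.symm (σ (Sum.elim Sum.inl _ j))) = _
  rcases j with j | j <;> simp

theorem extend_inputEmb (x' : Bits (Fin n)) :
    Function.extend (inputEmb σ) x' (basisState σ x g t) = basisState σ x' g t := by
  funext i
  by_cases h : ∃ j, inputEmb σ j = i
  · obtain ⟨j, rfl⟩ := h
    rw [(inputEmb σ).injective.extend_apply]
    exact (congrFun (basisState_inputEmb σ x' g t) j).symm
  · rw [Function.extend_apply' _ _ _ h]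
    obtain ⟨s, rfl⟩ := σ.surjective i
    rcases s with i | ⟨c, j⟩ | i
    · exact absurd ⟨i, rfl⟩ h
    · simp [basisState]
    · simp [basisState]

theorem extend_oracleEmb (c : Fin r) (x' : Bits (Fin n)) (u : Bits (Fin w ⊕ Unit)) :
    Function.extend (oracleEmb σ c) (Sum.elim x' u) (basisState σ x g t) =
      basisState σ x' (Function.update g c u) t := by
  funext i
  by_cases h : ∃ j, oracleEmb σ c j = i
  · obtain ⟨j, rfl⟩ := h
    rw [(oracleEmb σ c).injective.extend_apply]
    have hj := congrFun (basisState_oracleEmb σ x' (Function.update g c u) t c) j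
    rw [Function.update_self] at hj
    exact hj.symm
  · rw [Function.extend_apply' _ _ _ h]
    obtain ⟨s, rfl⟩ := σ.surjective i
    rcases s with i | ⟨c', j⟩ | i
    · exact absurd ⟨Sum.inl i, rfl⟩ h
    · have hc : c' ≠ c := by
        rintro rfl
        exact h ⟨Sum.inr j, rfl⟩
      simp [basisState, Function.update_of_ne hc]
    · simp [basisState]

theorem applyOn_inputEmb (A : QUnitary (Fin n)) (ψ : QState N) :
    applyOn (inputEmb σ) A ψ (basisState σ x g t) =
      ∑ x', A.val x x' * ψ (basisState σ x' g t) := by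
  simp only [applyOn, extend_inputEmb, basisState_inputEmb]

theorem applyOn_oracleEmb (c : Fin r) (O : QUnitary (OracleWire n w)) (ψ : QState N) :
    applyOn (oracleEmb σ c) O ψ (basisState σ x g t) =
      ∑ x' : Bits (Fin n), ∑ u : Bits (Fin w ⊕ Unit), O.val (Sum.elim x (g c)) (Sum.elim x' u) *
        ψ (basisState σ x' (Function.update g c u) t) := by
  simp only [applyOn, basisState_oracleEmb]
  rw [← (Equiv.sumArrowEquivProdArrow (Fin n) (Fin w ⊕ Unit) Bool).symm.sum_comp,
    Fintype.sum_prod_type]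
  refine Finset.sum_congr rfl fun x' _ => Finset.sum_congr rfl fun u _ => ?_
  have h1 : (Equiv.sumArrowEquivProdArrow (Fin n) (Fin w ⊕ Unit) Bool).symm (x', u) =
      Sum.elim x' u := rfl
  rw [h1, extend_oracleEmb]

end Layout

/-! ### Repeated oracle calls on separate registers -/

section Votes

variable {n w r m N : ℕ} (σ : SearchWire n w r m ≃ Fin N)
variable (A : QUnitary (Fin n)) (O : QUnitary (OracleWire n w))

/-- The amplitude of the register content `u` after the oracle was called on input `x` with a
cleared register. -/
def oracleAmp (x : Bits (Fin n)) (u : Bits (Fin w ⊕ Unit)) : ℂ :=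
  O.val (Sum.elim x u) (Sum.elim x (zeroBits _))

/-- The amplitude of the content `u` of register `c` after the first `k` registers were used. -/
def registerAmp (k : ℕ) (c : Fin r) (x : Bits (Fin n)) (u : Bits (Fin w ⊕ Unit)) : ℂ :=
  if c.val < k then oracleAmp O x u else if u = zeroBits _ then 1 else 0

/-- The oracle preserves every input when its register is cleared. -/
def PreservesInput : Prop :=
  ∀ (x y : Bits (Fin n)) (u : Bits (Fin w ⊕ Unit)), y ≠ x →
    O.val (Sum.elim y u) (Sum.elim x (zeroBits _)) = 0

/-- Call the oracle once on each of the first `k` registers. -/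
def votes : ℕ → QCircuit n w N
  | 0 => []
  | k + 1 => if h : k < r then votes k ++ [.query (oracleEmb σ ⟨k, h⟩)] else votes k

theorem cost_votes_le (k : ℕ) : (votes σ k).cost ≤ k := by
  induction k with
  | zero => simp [votes, QCircuit.cost]
  | succ k ih =>
    rw [votes]
    split_ifs
    · rw [QCircuit.cost_append]
      simpa [QCircuit.cost, QOp.cost] using ih
    · omega

/-- Each call preserves the input and meets a register that is still cleared, so the amplitude
factorises over the registers. Calls leave tags alone, so one tag can be followed whatever the other
sectors contain. -/
theorem run_votes_apply (hO : PreservesInput O) (k : ℕ) (t : Bits (Fin m)) (β : Bits (Fin n) → ℂ)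
    (ψ : QState N)
    (hψ : ∀ x g, ψ (basisState σ x g t) = if g = clearRegs then β x else 0)
    (x : Bits (Fin n)) (g : Fin r → Bits (Fin w ⊕ Unit)) :
    (votes σ k).run A O ψ (basisState σ x g t) = β x * ∏ c, registerAmp O k c x (g c) := by
  induction k generalizing x g with
  | zero =>
    rw [votes, QCircuit.run_nil, hψ]
    by_cases h : g = clearRegs
    · simp [h, registerAmp, clearRegs]
    · obtain ⟨c, hc⟩ := Function.ne_iff.mp h
      rw [if_neg h, Finset.prod_eq_zero (Finset.mem_univ c), mul_zero]
      simpa [registerAmp, clearRegs] using hc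
  | succ k ih =>
    rw [votes]
    split_ifs with hk
    · rw [QCircuit.run_append, QCircuit.run_singleton, QOp.unitary, ← applyOn_eq_mulVec,
        applyOn_oracleEmb]
      have key : ∀ (x' : Bits (Fin n)) (u : Bits (Fin w ⊕ Unit)),
          ∏ c, registerAmp O k c x' (Function.update g ⟨k, hk⟩ u c) =
            (if u = zeroBits _ then 1 else 0) *
              ∏ c ∈ Finset.univ.erase (⟨k, hk⟩ : Fin r), registerAmp O k c x' (g c) := by
        intro x' u
        rw [← Finset.mul_prod_erase _ _ (Finset.mem_univ (⟨k, hk⟩ : Fin r))]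
        congr 1
        · simp [registerAmp]
        · refine Finset.prod_congr rfl fun c hc => ?_
          rw [Function.update_of_ne (Finset.ne_of_mem_erase hc)]
      simp only [ih, key]
      rw [Finset.sum_eq_single x, Finset.sum_eq_single (zeroBits _)]
      · rw [← Finset.mul_prod_erase _ _ (Finset.mem_univ (⟨k, hk⟩ : Fin r))]
        have h1 : ∏ c ∈ Finset.univ.erase (⟨k, hk⟩ : Fin r), registerAmp O k c x (g c) =
            ∏ c ∈ Finset.univ.erase (⟨k, hk⟩ : Fin r), registerAmp O (k + 1) c x (g c) := by
          refine Finset.prod_congr rfl fun c hc => ?_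
          have hne : c.val ≠ k := fun h => Finset.ne_of_mem_erase hc (Fin.ext h)
          have hiff : c.val < k ↔ c.val < k + 1 := by omega
          simp only [registerAmp, hiff]
        have h2 : registerAmp O (k + 1) ⟨k, hk⟩ x (g ⟨k, hk⟩) = oracleAmp O x (g ⟨k, hk⟩) := by
          simp [registerAmp]
        rw [h1, h2, oracleAmp]
        simp
        ring
      · intro u _ hu
        simp [hu]
      · simp
      · intro x' _ hx'
        refine Finset.sum_eq_zero fun u _ => ?_
        by_cases hu : u = zeroBits _
        · rw [hu, hO x' x _ hx'.symm, zero_mul]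
        · simp [hu]
      · simp
    · rw [ih]
      congr 1
      refine Finset.prod_congr rfl fun c _ => ?_
      have h1 : c.val < k := by omega
      simp [registerAmp, h1, h1.trans (Nat.lt_succ_self k)]

theorem run_votes_eq_zero (hO : PreservesInput O) (k : ℕ) (t : Bits (Fin m)) (ψ : QState N)
    (hψ : ∀ x g, ψ (basisState σ x g t) = 0) (x : Bits (Fin n))
    (g : Fin r → Bits (Fin w ⊕ Unit)) :
    (votes σ k).run A O ψ (basisState σ x g t) = 0 := by
  rw [run_votes_apply σ A O hO k t 0 ψ (by simpa using hψ)]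
  simp

/-- More than half of the first `k` registers carry a set flag. -/
def majority (k : ℕ) (g : Fin r → Bits (Fin w ⊕ Unit)) : Bool :=
  decide (k < 2 * (Finset.univ.filter fun c : Fin r =>
    c.val < k ∧ g c (Sum.inr ()) = true).card)

/-- The probability that `k` oracle calls on `x` give a majority of set flags. -/
noncomputable def majorityProb (r k : ℕ) (x : Bits (Fin n)) : ℝ :=
  ∑ g : Fin r → Bits (Fin w ⊕ Unit),
    if majority k g = true then ‖∏ c, registerAmp O k c x (g c)‖ ^ 2 else 0

end Votes

/-! ### Coherent majority vote with uncomputation -/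

section Check

variable {n w r m N : ℕ} (σ : SearchWire n w r m ≃ Fin N)
variable (A : QUnitary (Fin n)) (O : QUnitary (OracleWire n w))

/-- Exchange two tags of the basis states whose registers satisfy `P`. -/
def exchangeTags (P : (Fin r → Bits (Fin w ⊕ Unit)) → Bool) (a b : Bits (Fin m))
    (z : Bits (Fin N)) : Bits (Fin N) :=
  basisState σ (inputPart σ z) (registerPart σ z)
    (if P (registerPart σ z) = true then Equiv.swap a b (tagPart σ z) else tagPart σ z)

theorem exchangeTags_involutive (P : (Fin r → Bits (Fin w ⊕ Unit)) → Bool) (a b : Bits (Fin m)) :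
    Function.Involutive (exchangeTags σ P a b) := by
  intro z
  simp only [exchangeTags, inputPart_basisState, registerPart_basisState, tagPart_basisState]
  split_ifs <;> simp

/-- The gate that exchanges two tags of the basis states whose registers satisfy `P`. -/
def exchangeGate (P : (Fin r → Bits (Fin w ⊕ Unit)) → Bool) (a b : Bits (Fin m)) :
    QOp n w N :=
  .gate (involutionGate _ (exchangeTags_involutive σ P a b))

theorem run_exchangeGate (P : (Fin r → Bits (Fin w ⊕ Unit)) → Bool) (a b : Bits (Fin m))
    (ψ : QState N) (x : Bits (Fin n)) (g : Fin r → Bits (Fin w ⊕ Unit)) (t : Bits (Fin m)) :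
    QCircuit.run A O [exchangeGate σ P a b] ψ (basisState σ x g t) =
      ψ (basisState σ x g (if P g = true then Equiv.swap a b t else t)) := by
  rw [QCircuit.run_singleton, exchangeGate, QOp.unitary, involutionGate_mulVec]
  simp [exchangeTags]

theorem run_votes_single (hO : PreservesInput O) (k : ℕ) (x₀ x : Bits (Fin n))
    (g : Fin r → Bits (Fin w ⊕ Unit)) (t₀ t : Bits (Fin m)) :
    (votes σ k).run A O (Pi.single (basisState σ x₀ clearRegs t₀) 1) (basisState σ x g t) =
      if x = x₀ ∧ t = t₀ then ∏ c, registerAmp O k c x₀ (g c) else 0 := by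
  rw [run_votes_apply σ A O hO k t (fun y => if y = x₀ ∧ t = t₀ then 1 else 0)]
  · split_ifs with h
    · rw [h.1, one_mul]
    · simp
  · intro y g'
    simp only [Pi.single_apply, basisState_inj]
    by_cases hg : g' = clearRegs <;> simp [hg]

theorem run_inv_votes_clear (hO : PreservesInput O) (k : ℕ) (x : Bits (Fin n)) (t : Bits (Fin m))
    (φ : QState N) :
    (votes σ k).inv.run A O φ (basisState σ x clearRegs t) =
      ∑ g, star (∏ c, registerAmp O k c x (g c)) * φ (basisState σ x g t) := by
  rw [QCircuit.run_inv_apply, sum_basis σ, Finset.sum_eq_single x]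
  · refine Finset.sum_congr rfl fun g _ => ?_
    rw [Finset.sum_eq_single t]
    · rw [run_votes_single σ A O hO]
      simp
    · intro t' _ ht'
      rw [run_votes_single σ A O hO]
      simp [ht']
    · simp
  · intro x' _ hx'
    refine Finset.sum_eq_zero fun g _ => Finset.sum_eq_zero fun t' _ => ?_
    rw [run_votes_single σ A O hO]
    simp [hx']
  · simp

theorem run_inv_votes_eq_zero (hO : PreservesInput O) (k : ℕ) (t : Bits (Fin m)) (φ : QState N)
    (hφ : ∀ x g, φ (basisState σ x g t) = 0) (x : Bits (Fin n))
    (g : Fin r → Bits (Fin w ⊕ Unit)) :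
    (votes σ k).inv.run A O φ (basisState σ x g t) = 0 := by
  rw [QCircuit.run_inv_apply, sum_basis σ]
  refine Finset.sum_eq_zero fun x' _ => Finset.sum_eq_zero fun g' _ =>
    Finset.sum_eq_zero fun t' _ => ?_
  by_cases ht : t' = t
  · rw [ht, hφ, mul_zero]
  · rw [run_votes_eq_zero σ A O hO k t', star_zero, zero_mul]
    intro y g''
    simp [basisState_inj, ht]

/-- Check the input by a majority vote of `k` oracle calls: the tag `a` of a cleared state is
changed to `b`, and to `c` if the vote is positive; the registers are then uncomputed. -/
noncomputable def checkCircuit (k : ℕ) (a b c : Bits (Fin m)) : QCircuit n w N :=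
  [exchangeGate σ (fun g => decide (g = clearRegs)) a b] ++ votes σ k ++
    [exchangeGate σ (majority k) b c] ++ (votes σ k).inv

theorem cost_checkCircuit_le (k : ℕ) (a b c : Bits (Fin m)) :
    (checkCircuit σ k a b c).cost ≤ 2 * k := by
  have h := cost_votes_le σ k
  simp only [checkCircuit, QCircuit.cost_append, QCircuit.cost_inv]
  simp only [QCircuit.cost, exchangeGate, QOp.cost, List.map_cons, List.map_nil, List.sum_cons,
    List.sum_nil] at h ⊢
  omega

variable {σ}

/-- The coordinate is `⟨φ|Π|φ⟩` times the old amplitude, where `φ` is the state of the votes on `x`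
and `Π` projects onto positive votes. The empty tag `b` separates the cleared states from uncleared
ones with tag `a`, on which the oracle is arbitrary; since `c` is empty, negative votes contribute
nothing. -/
theorem run_checkCircuit_clear (hO : PreservesInput O) (k : ℕ) {a b c : Bits (Fin m)}
    (hac : a ≠ c) (hbc : b ≠ c) (ψ : QState N)
    (hb : ∀ x g, ψ (basisState σ x g b) = 0) (hc : ∀ x g, ψ (basisState σ x g c) = 0)
    (x : Bits (Fin n)) :
    (checkCircuit σ k a b c).run A O ψ (basisState σ x clearRegs c) =
      majorityProb O r k x * ψ (basisState σ x clearRegs a) := by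
  simp only [checkCircuit, QCircuit.run_append]
  rw [run_inv_votes_clear σ A O hO]
  simp only [run_exchangeGate, majorityProb, Complex.ofReal_sum, Finset.sum_mul]
  refine Finset.sum_congr rfl fun g _ => ?_
  by_cases hM : majority k g = true
  · simp only [hM, if_true, Equiv.swap_apply_right]
    rw [run_votes_apply σ A O hO k b (fun x => ψ (basisState σ x clearRegs a))]
    · push_cast
      have h := RCLike.conj_mul (K := ℂ) (∏ c, registerAmp O k c x (g c))
      calc _ = (starRingEnd ℂ (∏ c, registerAmp O k c x (g c)) *
            ∏ c, registerAmp O k c x (g c)) * ψ (basisState σ x clearRegs a) := by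
            rw [starRingEnd_apply]; ring
        _ = _ := by rw [h]; simp
    · intro x g
      rw [run_exchangeGate]
      by_cases hg : g = clearRegs
      · simp [hg]
      · simp [hg, hb]
  · simp only [hM, Bool.false_eq_true, if_false]
    rw [run_votes_eq_zero σ A O hO k]
    · simp
    · intro x g
      rw [run_exchangeGate]
      split_ifs
      · rw [Equiv.swap_apply_of_ne_of_ne hac.symm hbc.symm, hc]
      · exact hc x g

/-- Neither exchange involves `t` and the votes preserve tags; so tags reserved for later rounds
remain empty. -/
theorem run_checkCircuit_eq_zero (hO : PreservesInput O) (k : ℕ) {a b c t : Bits (Fin m)}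
    (hta : t ≠ a) (htb : t ≠ b) (htc : t ≠ c) (ψ : QState N)
    (ht : ∀ x g, ψ (basisState σ x g t) = 0) (x : Bits (Fin n))
    (g : Fin r → Bits (Fin w ⊕ Unit)) :
    (checkCircuit σ k a b c).run A O ψ (basisState σ x g t) = 0 := by
  simp only [checkCircuit, QCircuit.run_append]
  apply run_inv_votes_eq_zero σ A O hO
  intro x g
  rw [run_exchangeGate, Equiv.swap_apply_of_ne_of_ne htb htc, ite_self]
  apply run_votes_eq_zero σ A O hO
  intro x g
  rw [run_exchangeGate, Equiv.swap_apply_of_ne_of_ne hta htb, ite_self]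
  exact ht x g

end Check

/-! ### Amplitude amplification by one round -/

section Amplification

variable {n w N : ℕ} (A : QUnitary (Fin n)) (O : QUnitary (OracleWire n w))

/-- One round of amplitude amplification of the basis states that satisfy `P`. -/
noncomputable def amplify (P : Bits (Fin N) → Bool) (c : QCircuit n w N) : QCircuit n w N :=
  c ++ [.gate (signGate P)] ++ c.inv ++ [.gate (signGate fun z => decide (z ≠ zeroBits _))] ++ c

theorem cost_amplify (P : Bits (Fin N) → Bool) (c : QCircuit n w N) :
    (amplify P c).cost = 3 * c.cost := by
  simp only [amplify, QCircuit.cost_append, QCircuit.cost_inv]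
  simp only [QCircuit.cost, QOp.cost, List.map_cons, List.map_nil, List.sum_cons, List.sum_nil]
  omega

theorem QCircuit.run_add (c : QCircuit n w N) (ψ φ : QState N) :
    c.run A O (ψ + φ) = c.run A O ψ + c.run A O φ := Matrix.mulVec_add _ _ _

theorem QCircuit.run_smul (c : QCircuit n w N) (k : ℂ) (ψ : QState N) :
    c.run A O (k • ψ) = k • c.run A O ψ := Matrix.mulVec_smul _ _ _

theorem QCircuit.run_run_inv (c : QCircuit n w N) (ψ : QState N) :
    c.run A O (c.inv.run A O ψ) = ψ := by
  rw [run, run, unitary_inv, Matrix.mulVec_mulVec]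
  have h1 : (unitary A O c).val * ((unitary A O c)⁻¹).val = 1 :=
    congrArg Subtype.val (mul_inv_cancel (unitary A O c))
  rw [h1, Matrix.one_mulVec]

/-- The probability of finding a basis state that satisfies `P`. -/
noncomputable def weight (P : Bits (Fin N) → Bool) (ψ : QState N) : ℝ :=
  ∑ z, if P z = true then ‖ψ z‖ ^ 2 else 0

/-- The round is the sign flip on `P` followed by `2|ψ⟩⟨ψ| - 1`. With weight `sin² θ`, the factor on
`P` is `sin 3θ / sin θ`. Every coordinate is merely rescaled, so empty tags stay empty. -/
theorem run_amplify (P : Bits (Fin N) → Bool) (c : QCircuit n w N) (z : Bits (Fin N)) :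
    (amplify P c).run A O (initState N) z =
      (if P z = true then (3 - 4 * weight P (c.run A O (initState N)) : ℂ)
        else 1 - 4 * weight P (c.run A O (initState N))) * c.run A O (initState N) z := by
  set ψ := c.run A O (initState N) with hψ
  simp only [amplify, QCircuit.run_append, QCircuit.run_singleton, QOp.unitary]
  set D := (signGate P).val.mulVec ψ with hD
  set η := c.inv.run A O D with hη
  have hη0 : η (zeroBits _) = 1 - 2 * weight P ψ := by
    have hn : ∑ z, ‖ψ z‖ ^ 2 = 1 := QCircuit.sum_norm_sq_run_init A O c
    rw [hη, QCircuit.run_inv_apply]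
    change ∑ z', star (ψ z') * D z' = _
    have h1 : ∀ z', star (ψ z') * D z' =
        ((‖ψ z'‖ ^ 2 - 2 * (if P z' = true then ‖ψ z'‖ ^ 2 else 0) : ℝ) : ℂ) := by
      intro z'
      have h2 : star (ψ z') * ψ z' = ((‖ψ z'‖ ^ 2 : ℝ) : ℂ) := by
        have := RCLike.conj_mul (K := ℂ) (ψ z')
        rw [starRingEnd_apply] at this
        rw [this]; simp
      rw [hD, signGate_mulVec]
      split_ifs
      · rw [mul_neg, h2]; push_cast; ring
      · rw [h2]; push_cast; ring
    rw [Finset.sum_congr rfl fun z' _ => h1 z', ← Complex.ofReal_sum, Finset.sum_sub_distrib,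
      hn, ← Finset.mul_sum, weight]
    push_cast
    rfl
  have hR : (signGate fun z => decide (z ≠ zeroBits _)).val.mulVec η =
      (2 * η (zeroBits _)) • initState N + (-1 : ℂ) • η := by
    funext z
    rw [signGate_mulVec]
    by_cases hz : z = zeroBits _
    · simp [hz, initState]; ring
    · simp [hz, initState]
  rw [hR, QCircuit.run_add, QCircuit.run_smul, QCircuit.run_smul, hη, QCircuit.run_run_inv, ← hη,
    ← hψ, hη0]
  simp only [Pi.add_apply, Pi.smul_apply, smul_eq_mul, hD, signGate_mulVec]
  split_ifs <;> ring

end Amplification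

/-! ### Stages: amplification alternating with checks -/

/-- The amplitudes of the cleared states after `j` rounds of amplification, each followed by a
check that multiplies the amplitude of `x` by `q j x`. -/
noncomputable def checkedAmp {X : Type*} [Fintype X] (α : X → ℂ) (q : ℕ → X → ℝ) : ℕ → X → ℂ
  | 0, x => q 0 x * α x
  | j + 1, x =>
      q (j + 1) x * ((3 - 4 * ((∑ y, ‖checkedAmp α q j y‖ ^ 2 : ℝ) : ℂ)) * checkedAmp α q j x)

section Stage

variable {n w r m N : ℕ} (σ : SearchWire n w r m ≃ Fin N)
variable (A : QUnitary (Fin n)) (O : QUnitary (OracleWire n w))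

/-- The basis states with cleared registers and tag `t`. -/
def clearSector (t : Bits (Fin m)) (z : Bits (Fin N)) : Bool :=
  decide (registerPart σ z = clearRegs ∧ tagPart σ z = t)

theorem sum_clearSector (t : Bits (Fin m)) (F : Bits (Fin N) → ℝ) :
    (∑ z, if clearSector σ t z = true then F z else 0) =
      ∑ x, F (basisState σ x clearRegs t) := by
  rw [sum_basis σ]
  refine Finset.sum_congr rfl fun x _ => ?_
  rw [Finset.sum_eq_single clearRegs, Finset.sum_eq_single t]
  · simp [clearSector]
  · intro t' _ ht
    simp [clearSector, ht]
  · simp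
  · intro g _ hg
    simp [clearSector, hg]
  · simp

/-- Prepare, then alternate checks (with `k j` votes in round `j`) and amplification. -/
noncomputable def stageCircuit (τ : ℕ → Bits (Fin m)) (k : ℕ → ℕ) : ℕ → QCircuit n w N
  | 0 => [.prep (inputEmb σ)] ++ checkCircuit σ (k 0) (τ 0) (τ 1) (τ 2)
  | j + 1 => amplify (clearSector σ (τ (2 * j + 2))) (stageCircuit τ k j) ++
      checkCircuit σ (k (j + 1)) (τ (2 * j + 2)) (τ (2 * j + 3)) (τ (2 * j + 4))

theorem run_prep_init (x : Bits (Fin n)) (g : Fin r → Bits (Fin w ⊕ Unit)) (t : Bits (Fin m)) :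
    QCircuit.run A O [.prep (inputEmb σ)] (initState N) (basisState σ x g t) =
      if g = clearRegs ∧ t = zeroBits _ then amplitude A x else 0 := by
  rw [QCircuit.run_singleton, QOp.unitary, ← applyOn_eq_mulVec, applyOn_inputEmb,
    Finset.sum_eq_single (zeroBits _)]
  · rw [initState, ← basisState_zero σ]
    by_cases h : g = clearRegs ∧ t = zeroBits _
    · rw [if_pos h, h.1, h.2]
      simp [amplitude]
    · have h' : basisState σ (zeroBits _) g t ≠ basisState σ (zeroBits _) clearRegs (zeroBits _) :=
        fun h'' => h ((basisState_inj σ _ _ _).mp h'').2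
      rw [if_neg h, Pi.single_eq_of_ne h', mul_zero]
  · intro x' _ hx'
    have h' : basisState σ x' g t ≠ basisState σ (zeroBits _) clearRegs (zeroBits _) :=
      fun h'' => hx' ((basisState_inj σ _ _ _).mp h'').1
    rw [initState, ← basisState_zero σ, Pi.single_eq_of_ne h', mul_zero]
  · simp

variable {σ}

/-- Round `j` uses up the tags `2j+1` and `2j+2`. Emptiness of all higher tags is carried along
because the next check requires it. -/
theorem run_stageCircuit (hO : PreservesInput O) {τ : ℕ → Bits (Fin m)} {M : ℕ}
    (hτ : Set.InjOn τ (Set.Iic M)) (hτ0 : τ 0 = zeroBits _) (k : ℕ → ℕ) (j : ℕ)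
    (hj : 2 * j + 2 ≤ M) :
    (∀ x, (stageCircuit σ τ k j).run A O (initState N) (basisState σ x clearRegs (τ (2 * j + 2))) =
      checkedAmp (amplitude A) (fun j => majorityProb O r (k j)) j x) ∧
    ∀ i, 2 * j + 2 < i → i ≤ M → ∀ x g,
      (stageCircuit σ τ k j).run A O (initState N) (basisState σ x g (τ i)) = 0 := by
  have hne : ∀ {a b : ℕ}, a ≤ M → b ≤ M → a ≠ b → τ a ≠ τ b :=
    fun ha hb hab h => hab (hτ ha hb h)
  induction j with
  | zero =>
    have hz : ∀ i, 0 < i → i ≤ M → ∀ x g, QCircuit.run A O [.prep (inputEmb σ)] (initState N)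
        (basisState σ x g (τ i)) = 0 := by
      intro i hi hiM x g
      rw [run_prep_init, if_neg]
      rintro ⟨-, h⟩
      exact hne hiM (Nat.zero_le _) hi.ne' (h.trans hτ0.symm)
    constructor
    · intro x
      rw [stageCircuit, QCircuit.run_append, mul_zero, zero_add,
        run_checkCircuit_clear A O hO _ (hne (by omega) (by omega) (by omega))
          (hne (by omega) (by omega) (by omega)) _ (hz 1 (by omega) (by omega))
          (hz 2 (by omega) (by omega)), run_prep_init]
      simp [hτ0, checkedAmp]
    · intro i hi hiM x g
      rw [stageCircuit, QCircuit.run_append]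
      exact run_checkCircuit_eq_zero A O hO _ (hne hiM (by omega) (by omega))
        (hne hiM (by omega) (by omega)) (hne hiM (by omega) (by omega)) _
        (hz i (by omega) hiM) x g
  | succ j ih =>
    obtain ⟨ih1, ih2⟩ := ih (by omega)
    have hz : ∀ i, 2 * j + 2 < i → i ≤ M → ∀ x g,
        (amplify (clearSector σ (τ (2 * j + 2))) (stageCircuit σ τ k j)).run A O (initState N)
          (basisState σ x g (τ i)) = 0 := by
      intro i hi hiM x g
      rw [run_amplify, ih2 i hi hiM, mul_zero]
    constructor
    · intro x
      rw [stageCircuit, QCircuit.run_append, show 2 * (j + 1) + 2 = 2 * j + 4 by ring,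
        run_checkCircuit_clear A O hO _ (hne (by omega) (by omega) (by omega))
          (hne (by omega) (by omega) (by omega)) _ (hz _ (by omega) (by omega))
          (hz _ (by omega) (by omega)), run_amplify, ih1, checkedAmp, weight, sum_clearSector]
      simp [clearSector, ih1]
    · intro i hi hiM x g
      rw [stageCircuit, QCircuit.run_append]
      exact run_checkCircuit_eq_zero A O hO _ (hne hiM (by omega) (by omega))
        (hne hiM (by omega) (by omega)) (hne hiM (by omega) (by omega)) _
        (hz i (by omega) hiM) x g

/-- The probability that stage `j` ends in its cleared sector with input `x`. -/
theorem norm_sq_run_stageCircuit (hO : PreservesInput O) {τ : ℕ → Bits (Fin m)} {M : ℕ}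
    (hτ : Set.InjOn τ (Set.Iic M)) (hτ0 : τ 0 = zeroBits _) (k : ℕ → ℕ) (j : ℕ)
    (hj : 2 * j + 2 ≤ M) (F : Bits (Fin n) → ℝ) :
    (∑ z, ‖(stageCircuit σ τ k j).run A O (initState N) z‖ ^ 2 *
        if clearSector σ (τ (2 * j + 2)) z = true then F (inputPart σ z) else 0) =
      ∑ x, ‖checkedAmp (amplitude A) (fun j => majorityProb O r (k j)) j x‖ ^ 2 * F x := by
  simp only [mul_ite, mul_zero]
  rw [sum_clearSector]
  refine Finset.sum_congr rfl fun x _ => ?_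
  rw [(run_stageCircuit A O hO hτ hτ0 k j hj).1, inputPart_basisState]

/-- The costs satisfy `c 0 ≤ 4μ` and `c (j+1) ≤ 3 c j + 4(j+2)μ`; the term `μ(2j+5)` is the linear
correction that makes the bound inductive. -/
theorem cost_stageCircuit_le (τ : ℕ → Bits (Fin m)) (μ j : ℕ) :
    (stageCircuit σ τ (fun j => 2 * ((j + 1) * μ)) j).cost + μ * (2 * j + 5) ≤ μ * (9 * 3 ^ j) := by
  induction j with
  | zero =>
    rw [stageCircuit, QCircuit.cost_append]
    have h := cost_checkCircuit_le σ (2 * ((0 + 1) * μ)) (τ 0) (τ 1) (τ 2)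
    have h' : QCircuit.cost [QOp.prep (n := n) (w := w) (inputEmb σ)] = 0 := rfl
    rw [h']
    omega
  | succ j ih =>
    rw [stageCircuit, QCircuit.cost_append, cost_amplify]
    have h := cost_checkCircuit_le σ (2 * ((j + 1 + 1) * μ)) (τ (2 * j + 2)) (τ (2 * j + 3))
      (τ (2 * j + 4))
    rw [pow_succ]
    nlinarith

end Stage

/-! ### Statistics of the flag and a Chernoff bound -/

theorem unitary_sum_norm_sq_col {κ : Type} [Fintype κ] [DecidableEq κ]
    (U : ↥(Matrix.unitaryGroup κ ℂ)) (j : κ) : ∑ i, ‖U.val i j‖ ^ 2 = 1 := by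
  have h := congrFun (congrFun (Matrix.mem_unitaryGroup_iff'.mp U.2) j) j
  rw [Matrix.mul_apply, Matrix.one_apply_eq] at h
  have h2 : ((∑ i, ‖U.val i j‖ ^ 2 : ℝ) : ℂ) = 1 := by
    rw [← h]
    push_cast
    refine Finset.sum_congr rfl fun i _ => ?_
    exact (RCLike.conj_mul (K := ℂ) _).symm
  exact_mod_cast h2

section OracleStatistics

variable {n w : ℕ} {f : Bits (Fin n) → Bool} {p : ℝ} {O : QUnitary (OracleWire n w)}

theorem zeroBits_sum (w : ℕ) :
    zeroBits (Fin w ⊕ Unit) = Sum.elim (zeroBits (Fin w)) (fun _ => false) := by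
  funext j
  rcases j with j | j <;> rfl

theorem sum_bits_flag {M : Type*} [AddCommMonoid M] (F : Bits (Fin w ⊕ Unit) → M) :
    ∑ u, F u = ∑ b : Bool, ∑ g : Bits (Fin w), F (Sum.elim g (fun _ => b)) := by
  rw [← (Equiv.sumArrowEquivProdArrow (Fin w) Unit Bool).symm.sum_comp, Fintype.sum_prod_type,
    Finset.sum_comm, ← (Equiv.funUnique Unit Bool).symm.sum_comp]
  rfl

theorem IsBiasedOracle.preservesInput (hO : IsBiasedOracle f p O) : PreservesInput O := by
  intro x y u hyx
  have h := (hO x).1 y (fun i => u (Sum.inl i)) (u (Sum.inr ())) hyx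
  have hu : u = Sum.elim (fun i => u (Sum.inl i)) (fun _ => u (Sum.inr ())) := by
    funext j
    rcases j with j | j <;> rfl
  rw [hu, zeroBits_sum]
  exact h

theorem IsBiasedOracle.le_sum_correct (hO : IsBiasedOracle f p O) (x : Bits (Fin n)) :
    p ≤ ∑ u : Bits (Fin w ⊕ Unit),
      if u (Sum.inr ()) = f x then ‖oracleAmp O x u‖ ^ 2 else 0 := by
  refine (hO x).2.trans (le_of_eq ?_)
  rw [sum_bits_flag, Finset.sum_eq_single (f x)]
  · simp only [Sum.elim_inr, if_true, oracleAmp, zeroBits_sum]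
    rfl
  · intro b _ hb
    simp [hb]
  · simp

theorem PreservesInput.sum_norm_sq_oracleAmp (hO : PreservesInput O) (x : Bits (Fin n)) :
    ∑ u, ‖oracleAmp O x u‖ ^ 2 = 1 := by
  rw [← unitary_sum_norm_sq_col O (Sum.elim x (zeroBits _)),
    ← (Equiv.sumArrowEquivProdArrow (Fin n) (Fin w ⊕ Unit) Bool).symm.sum_comp,
    Fintype.sum_prod_type, Finset.sum_eq_single x]
  · rfl
  · intro y _ hy
    refine Finset.sum_eq_zero fun u _ => ?_
    have h : (Equiv.sumArrowEquivProdArrow (Fin n) (Fin w ⊕ Unit) Bool).symm (y, u) =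
      Sum.elim y u := rfl
    rw [h, hO x y u hy]
    simp
  · simp

end OracleStatistics

/-- A Chernoff bound: if every one of the first `k` of `r` independent trials is a success (`b`
holds) with probability at least `p > 1/2`, then at most half of them are successes with
probability at most `(4 p (1 - p)) ^ (k / 2)`. -/
theorem sum_minority_le {U : Type*} [Fintype U] {r v : ℕ} (hv : 2 * v ≤ r) {p : ℝ}
    (hp : 1 / 2 < p) (hp1 : p < 1) (b : U → Prop) [DecidablePred b] (h : Fin r → U → ℝ)
    (h0 : ∀ c u, 0 ≤ h c u) (h1 : ∀ c, ∑ u, h c u = 1)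
    (hb : ∀ c : Fin r, c.val < 2 * v → p ≤ ∑ u, if b u then h c u else 0) :
    (∑ g : Fin r → U,
      if (Finset.univ.filter fun c : Fin r => c.val < 2 * v ∧ b (g c)).card ≤ v then
        ∏ c, h c (g c) else 0) ≤ (4 * p * (1 - p)) ^ v := by
  -- This tilt minimises `p s⁻¹ + (1 - p) s`; the minimum is `2 √(p (1 - p))`.
  set s : ℝ := √(p / (1 - p)) with hs
  have hq : 0 < 1 - p := by linarith
  have hs2 : s ^ 2 = p / (1 - p) := Real.sq_sqrt (by positivity)
  have hs1 : 1 ≤ s := by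
    rw [hs, Real.one_le_sqrt, le_div_iff₀ hq]
    linarith
  have hs0 : 0 < s := by linarith
  have hcard : (Finset.univ.filter fun c : Fin r => c.val < 2 * v).card = 2 * v := by
    have := Fin.card_filter_val_lt (n := r) (m := 2 * v)
    rw [this]; omega
  -- If at most `v` of the `2 * v` trials succeed, failures are at least as many as successes; the
  -- product of these weights is then at least `1` and dominates the indicator.
  set S : Fin r → U → ℝ := fun c u => if c.val < 2 * v then (if b u then s⁻¹ else s) else 1 with hS
  have hS0 : ∀ c u, 0 ≤ S c u := by
    intro c u
    simp only [hS]
    split_ifs <;> positivity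
  have hprod : ∀ g : Fin r → U,
      (Finset.univ.filter fun c : Fin r => c.val < 2 * v ∧ b (g c)).card ≤ v →
        1 ≤ ∏ c, S c (g c) := by
    intro g hg
    simp only [hS]
    rw [← Finset.prod_filter, Finset.prod_ite, Finset.prod_const, Finset.prod_const,
      Finset.filter_filter, Finset.filter_filter]
    have hsum := Finset.card_filter_add_card_filter_not
      (s := Finset.univ.filter fun c : Fin r => c.val < 2 * v) (fun c => b (g c))
    rw [Finset.filter_filter, Finset.filter_filter, hcard] at hsum
    set a₁ := (Finset.univ.filter fun c : Fin r => c.val < 2 * v ∧ b (g c)).card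
    set a₂ := (Finset.univ.filter fun c : Fin r => c.val < 2 * v ∧ ¬ b (g c)).card
    obtain ⟨d, hd⟩ : ∃ d, a₂ = a₁ + d := ⟨a₂ - a₁, by omega⟩
    rw [hd, pow_add, ← mul_assoc, ← mul_pow, inv_mul_cancel₀ hs0.ne', one_pow, one_mul]
    exact one_le_pow₀ hs1
  calc _ ≤ ∑ g : Fin r → U, ∏ c, h c (g c) * S c (g c) := by
        refine Finset.sum_le_sum fun g _ => ?_
        rw [Finset.prod_mul_distrib]
        have hnn : 0 ≤ ∏ c, h c (g c) := Finset.prod_nonneg fun c _ => h0 c _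
        split_ifs with hg
        · exact le_mul_of_one_le_right hnn (hprod g hg)
        · exact mul_nonneg hnn (Finset.prod_nonneg fun c _ => hS0 c _)
    _ = ∏ c, ∑ u, h c u * S c u := by
        rw [Finset.prod_univ_sum, Fintype.piFinset_univ]
    _ ≤ ∏ c : Fin r, (if c.val < 2 * v then p * s⁻¹ + (1 - p) * s else 1) := by
        refine Finset.prod_le_prod
          (fun c _ => Finset.sum_nonneg fun u _ => mul_nonneg (h0 c u) (hS0 c u)) fun c _ => ?_
        by_cases hc : c.val < 2 * v
        · rw [if_pos hc]
          have e : ∀ u, h c u * S c u =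
              h c u * s - (s - s⁻¹) * (if b u then h c u else 0) := by
            intro u
            simp only [hS, hc, if_true]
            split_ifs <;> ring
          rw [Finset.sum_congr rfl fun u _ => e u, Finset.sum_sub_distrib, ← Finset.sum_mul, h1,
            ← Finset.mul_sum]
          have hss : s⁻¹ ≤ s := (inv_le_one_of_one_le₀ hs1).trans hs1
          nlinarith [mul_le_mul_of_nonneg_left (hb c hc) (sub_nonneg.mpr hss)]
        · rw [if_neg hc]
          simp [hS, hc, h1]
    _ = ((p * s⁻¹ + (1 - p) * s) ^ 2) ^ v := by
        rw [← Finset.prod_filter, Finset.prod_const, hcard, pow_mul]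
    _ = _ := by
        congr 1
        have e : p * s⁻¹ = (1 - p) * s := by
          have : p = (1 - p) * s ^ 2 := by rw [hs2]; field_simp
          field_simp
          linarith
        rw [e, ← two_mul, mul_pow, mul_pow, hs2]
        field_simp
        ring

/-! ### Error of the majority vote -/

section Majority

variable {n w : ℕ} {f : Bits (Fin n) → Bool} {p : ℝ} {O : QUnitary (OracleWire n w)} {r v : ℕ}

theorem sum_norm_sq_registerAmp (hO : PreservesInput O) (k : ℕ) (c : Fin r) (x : Bits (Fin n)) :
    ∑ u, ‖registerAmp O k c x u‖ ^ 2 = 1 := by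
  by_cases hc : c.val < k
  · simpa only [registerAmp, hc, if_true] using hO.sum_norm_sq_oracleAmp x
  · simp only [registerAmp, hc, if_false]
    rw [Finset.sum_eq_single (zeroBits _)] <;> simp +contextual

theorem majorityProb_add (hO : PreservesInput O) (k : ℕ) (x : Bits (Fin n)) :
    majorityProb O r k x + (∑ g : Fin r → Bits (Fin w ⊕ Unit),
      if majority k g = true then 0 else ∏ c, ‖registerAmp O k c x (g c)‖ ^ 2) = 1 := by
  have h : ∑ g : Fin r → Bits (Fin w ⊕ Unit), ∏ c, ‖registerAmp O k c x (g c)‖ ^ 2 = 1 := by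
    have := Finset.prod_univ_sum (fun _ : Fin r => (Finset.univ : Finset (Bits (Fin w ⊕ Unit))))
      (fun c u => ‖registerAmp O k c x u‖ ^ 2)
    rw [Fintype.piFinset_univ] at this
    rw [← this]
    exact Finset.prod_eq_one fun c _ => sum_norm_sq_registerAmp hO k c x
  rw [majorityProb, ← Finset.sum_add_distrib, ← h]
  refine Finset.sum_congr rfl fun g _ => ?_
  split_ifs <;> simp [norm_prod, Finset.prod_pow]

theorem majorityProb_nonneg (k : ℕ) (x : Bits (Fin n)) : 0 ≤ majorityProb O r k x :=
  Finset.sum_nonneg fun g _ => by split_ifs <;> positivity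

theorem majorityProb_le_one (hO : PreservesInput O) (k : ℕ) (x : Bits (Fin n)) :
    majorityProb O r k x ≤ 1 := by
  have h := majorityProb_add (r := r) hO k x
  have h' : 0 ≤ ∑ g : Fin r → Bits (Fin w ⊕ Unit),
      if majority k g = true then 0 else ∏ c, ‖registerAmp O k c x (g c)‖ ^ 2 :=
    Finset.sum_nonneg fun g _ => by split_ifs <;> positivity
  linarith

variable (hO : IsBiasedOracle f p O) (hp : 1 / 2 < p) (hp1 : p < 1) (hv : 2 * v ≤ r)
include hO hp hp1 hv

theorem IsBiasedOracle.sum_minority_registerAmp_le (x : Bits (Fin n)) :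
    (∑ g : Fin r → Bits (Fin w ⊕ Unit),
      if (Finset.univ.filter fun c : Fin r => c.val < 2 * v ∧ g c (Sum.inr ()) = f x).card ≤ v then
        ∏ c, ‖registerAmp O (2 * v) c x (g c)‖ ^ 2 else 0) ≤ (4 * p * (1 - p)) ^ v := by
  refine sum_minority_le hv hp hp1 (fun u : Bits (Fin w ⊕ Unit) => u (Sum.inr ()) = f x)
    (fun c u => ‖registerAmp O (2 * v) c x u‖ ^ 2) (fun c u => by positivity)
    (fun c => sum_norm_sq_registerAmp hO.preservesInput _ c x) fun c hc => ?_
  simpa only [registerAmp, hc, if_true] using hO.le_sum_correct x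

/-- A positive vote needs a strict majority and the tail bound includes ties, so the same bound
covers false negatives here and false positives in `IsBiasedOracle.majorityProb_le`. -/
theorem IsBiasedOracle.le_majorityProb (x : Bits (Fin n)) (hx : f x = true) :
    1 - (4 * p * (1 - p)) ^ v ≤ majorityProb O r (2 * v) x := by
  have h := majorityProb_add (r := r) hO.preservesInput (2 * v) x
  have h' := hO.sum_minority_registerAmp_le hp hp1 hv x
  rw [hx] at h'
  have : (∑ g : Fin r → Bits (Fin w ⊕ Unit),
      if majority (2 * v) g = true then 0 else ∏ c, ‖registerAmp O (2 * v) c x (g c)‖ ^ 2) ≤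
      (4 * p * (1 - p)) ^ v := by
    refine le_trans (le_of_eq (Finset.sum_congr rfl fun g _ => ?_)) h'
    by_cases hM : majority (2 * v) g = true
    · rw [if_pos hM, if_neg]
      simp only [majority, decide_eq_true_eq] at hM
      omega
    · rw [if_neg hM, if_pos]
      simp only [majority, decide_eq_true_eq] at hM
      omega
  linarith

theorem IsBiasedOracle.majorityProb_le (x : Bits (Fin n)) (hx : f x = false) :
    majorityProb O r (2 * v) x ≤ (4 * p * (1 - p)) ^ v := by
  refine le_trans (Finset.sum_le_sum fun g _ => ?_) (hO.sum_minority_registerAmp_le hp hp1 hv x)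
  have hnn : 0 ≤ ∏ c, ‖registerAmp O (2 * v) c x (g c)‖ ^ 2 := by positivity
  by_cases hM : majority (2 * v) g = true
  · rw [if_pos hM, if_pos]
    · simp [norm_prod, Finset.prod_pow]
    · simp only [majority, decide_eq_true_eq] at hM
      have hsum := Finset.card_filter_add_card_filter_not
        (s := Finset.univ.filter fun c : Fin r => c.val < 2 * v) (fun c => g c (Sum.inr ()) = true)
      rw [Finset.filter_filter, Finset.filter_filter,
        Fin.card_filter_val_lt (n := r) (m := 2 * v)] at hsum
      simp only [Bool.not_eq_true] at hsum
      rw [hx]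
      omega
  · rw [if_neg hM]
    split_ifs <;> simp [hnn]

end Majority

/-! ### Growth of the good weight, decay of the bad weight -/

section AmplitudeGrowth

variable {X : Type*} [Fintype X] (α : X → ℂ) (q : ℕ → X → ℝ) (f : X → Bool)

/-- The total weight after round `j` of the elements `x` with `f x = b`. -/
noncomputable def checkedWeight (b : Bool) (j : ℕ) : ℝ :=
  ∑ x, if f x = b then ‖checkedAmp α q j x‖ ^ 2 else 0

theorem checkedWeight_nonneg (b : Bool) (j : ℕ) : 0 ≤ checkedWeight α q f b j :=
  Finset.sum_nonneg fun x _ => by split_ifs <;> positivity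

theorem checkedWeight_add (j : ℕ) :
    checkedWeight α q f true j + checkedWeight α q f false j = ∑ x, ‖checkedAmp α q j x‖ ^ 2 := by
  rw [checkedWeight, checkedWeight, ← Finset.sum_add_distrib]
  refine Finset.sum_congr rfl fun x _ => ?_
  cases f x <;> simp

theorem norm_sq_checkedAmp_succ (j : ℕ) (x : X) :
    ‖checkedAmp α q (j + 1) x‖ ^ 2 =
      (q (j + 1) x) ^ 2 * (3 - 4 * ∑ y, ‖checkedAmp α q j y‖ ^ 2) ^ 2 *
        ‖checkedAmp α q j x‖ ^ 2 := by
  have h : checkedAmp α q (j + 1) x =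
      ((q (j + 1) x * (3 - 4 * ∑ y, ‖checkedAmp α q j y‖ ^ 2) : ℝ) : ℂ) *
        checkedAmp α q j x := by
    rw [checkedAmp]
    push_cast
    ring
  rw [h, norm_mul, Complex.norm_real, mul_pow, Real.norm_eq_abs, sq_abs, mul_pow]

variable {α q f}

/-- A total weight in `[0, 1]` makes amplification multiply weights by at most `9`, and a check
multiplies bad ones by at most `1 / 10000`. The crude rate `1 / 2` already gives summable bounds. -/
theorem checkedWeight_false_le (hα : ∑ x, ‖α x‖ ^ 2 ≤ 1) (hq0 : ∀ j x, 0 ≤ q j x) {K : ℕ}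
    (hs : ∀ j < K, ∑ x, ‖checkedAmp α q j x‖ ^ 2 ≤ 1)
    (hbad : ∀ j ≤ K, ∀ x, f x = false → q j x ≤ (1 / 100) ^ (j + 1)) (j : ℕ) (hj : j ≤ K) :
    checkedWeight α q f false j ≤ 1 / 10000 * (1 / 2) ^ j := by
  induction j with
  | zero =>
    have h : checkedWeight α q f false 0 ≤ ∑ x, 1 / 10000 * ‖α x‖ ^ 2 := by
      refine Finset.sum_le_sum fun x _ => ?_
      split_ifs with hx
      · have h1 := hbad 0 hj x hx
        have h0 := hq0 0 x
        rw [checkedAmp, norm_mul, Complex.norm_real, mul_pow, Real.norm_eq_abs, sq_abs]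
        gcongr
        norm_num at h1
        nlinarith
      · positivity
    rw [← Finset.mul_sum] at h
    simp only [pow_zero, mul_one]
    linarith
  | succ j ih =>
    have ih := ih (by omega)
    have hs0 : 0 ≤ ∑ x, ‖checkedAmp α q j x‖ ^ 2 := by positivity
    have hs1 := hs j (by omega)
    have h : checkedWeight α q f false (j + 1) ≤ 1 / 2 * checkedWeight α q f false j := by
      rw [checkedWeight, checkedWeight, Finset.mul_sum]
      refine Finset.sum_le_sum fun x _ => ?_
      split_ifs with hx
      · rw [norm_sq_checkedAmp_succ]
        gcongr
        have h1 := hbad (j + 1) hj x hx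
        have h2 : ((1 : ℝ) / 100) ^ (j + 1 + 1) ≤ (1 / 100) ^ 1 :=
          pow_le_pow_of_le_one (by norm_num) (by norm_num) (by omega)
        have h0 := hq0 (j + 1) x
        have h3 : (q (j + 1) x) ^ 2 ≤ 1 / 10000 := by nlinarith
        have h4 : (3 - 4 * ∑ y, ‖checkedAmp α q j y‖ ^ 2) ^ 2 ≤ 9 := by nlinarith
        nlinarith [sq_nonneg (3 - 4 * ∑ y, ‖checkedAmp α q j y‖ ^ 2), sq_nonneg (q (j + 1) x)]
      · simp
    rw [pow_succ]
    linarith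

/-- Uses `(3 - 4s)² ≥ 9 - 24s` and `(1 - κ)² ≥ 1 - 2κ`. The bad part of `s` and `κ` are both at most
`2^(-j)/10000`, and `8/3 + 2 ≤ 10` gives the constant `1 / 1000`. -/
theorem checkedWeight_true_succ_ge
    {j : ℕ} (hsmall : checkedWeight α q f true j < 1 / 16)
    (hb : checkedWeight α q f false j ≤ 1 / 10000 * (1 / 2) ^ j)
    (hgood : ∀ x, f x = true → 1 - (1 / 100) ^ (j + 2) ≤ q (j + 1) x) :
    9 * (1 - (8 / 3 * checkedWeight α q f true j + 1 / 1000 * (1 / 2) ^ j)) *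
      checkedWeight α q f true j ≤ checkedWeight α q f true (j + 1) := by
  set G := checkedWeight α q f true j with hG
  set s := ∑ y, ‖checkedAmp α q j y‖ ^ 2 with hs
  have hsum := checkedWeight_add α q f j
  rw [← hs, ← hG] at hsum
  have hs0 : 0 ≤ s := by positivity
  have hhalf : ((1 : ℝ) / 2) ^ j ≤ 1 := pow_le_one₀ (by norm_num) (by norm_num)
  have hκ : ((1 : ℝ) / 100) ^ (j + 2) ≤ 1 / 10000 * (1 / 2) ^ j := by
    rw [pow_add, mul_comm]
    have : ((1 : ℝ) / 100) ^ j ≤ (1 / 2) ^ j := by gcongr; norm_num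
    norm_num at this ⊢
    linarith
  set κ : ℝ := (1 / 100) ^ (j + 2) with hκd
  have hκ0 : 0 ≤ κ := by positivity
  obtain ⟨c, hc⟩ : ∃ c, c = 9 * (1 - (8 / 3 * G + 1 / 1000 * (1 / 2) ^ j)) := ⟨_, rfl⟩
  rw [← hc, hG, checkedWeight, checkedWeight, Finset.mul_sum]
  refine Finset.sum_le_sum fun x _ => ?_
  split_ifs with hx
  · rw [norm_sq_checkedAmp_succ, ← hs]
    gcongr
    have h1 : (1 - κ) ^ 2 ≤ (q (j + 1) x) ^ 2 :=
      pow_le_pow_left₀ (by linarith) (hgood x hx) 2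
    have h2 : 0 ≤ (3 - 4 * s) ^ 2 := sq_nonneg _
    have h3 : 9 - 24 * s ≤ (3 - 4 * s) ^ 2 := by nlinarith
    calc c ≤ (1 - 2 * κ) * (9 - 24 * s) := by
          rw [hc]
          nlinarith
      _ ≤ (1 - κ) ^ 2 * (3 - 4 * s) ^ 2 := by
          apply mul_le_mul _ h3 _ (sq_nonneg _)
          · nlinarith
          · linarith
      _ ≤ _ := by gcongr
  · simp

/-- The relative losses must be summable: a constant loss in each of `K` rounds would cost a power
of `lam`. Below `1 / 16`, `G` at least quadruples, so `8/3 * G j ≤ 8/9 * (G (j+1) - G j)`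
telescopes; the remaining losses sum to at most `1 / 500`. -/
theorem exists_large_of_growth {G : ℕ → ℝ} {K : ℕ} {lam : ℝ} (hG0 : ∀ j, 0 ≤ G j)
    (h0 : 98 / 100 * lam ≤ G 0) (hK : 1 ≤ 9 ^ K * lam)
    (hG : ∀ j < K, G j < 1 / 16 →
      9 * (1 - (8 / 3 * G j + 1 / 1000 * (1 / 2) ^ j)) * G j ≤ G (j + 1)) :
    ∃ k ≤ K, 1 / 16 ≤ G k := by
  by_contra! hlt
  have key : ∀ j ≤ K, 9 ^ j * G 0 * (1 - (8 / 9 * G j + 1 / 500 * (1 - (1 / 2) ^ j))) ≤ G j := by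
    intro j hj
    induction j with
    | zero =>
      have := hG0 0
      norm_num
      nlinarith
    | succ j ih =>
      have ih := ih (by omega)
      have hl := hlt j (by omega)
      have hstep := hG j (by omega) hl
      have hGj := hG0 j
      have hhalf : ((1 : ℝ) / 2) ^ j ≤ 1 := pow_le_one₀ (by norm_num) (by norm_num)
      have hhalf0 : (0 : ℝ) < (1 / 2) ^ j := by positivity
      have h4 : 4 * G j ≤ G (j + 1) := by nlinarith
      set t : ℝ := (1 / 2) ^ j with ht
      set e := 8 / 3 * G j + 1 / 1000 * t with he
      have he1 : e ≤ 1 / 2 := by linarith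
      have he0 : 0 ≤ e := by positivity
      set Q := 9 ^ j * G 0 with hQ
      have hQ0 : 0 ≤ Q := mul_nonneg (by positivity) (hG0 0)
      have hd0 : 0 ≤ 8 / 9 * G j + 1 / 500 * (1 - t) := by nlinarith
      rw [pow_succ, pow_succ, ← ht]
      calc 9 ^ j * 9 * G 0 * (1 - (8 / 9 * G (j + 1) + 1 / 500 * (1 - t * (1 / 2))))
          ≤ 9 * Q * ((1 - e) * (1 - (8 / 9 * G j + 1 / 500 * (1 - t)))) := by
            rw [show (9 : ℝ) ^ j * 9 * G 0 = 9 * Q by rw [hQ]; ring]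
            gcongr
            nlinarith [mul_nonneg he0 hd0]
        _ = 9 * (1 - e) * (Q * (1 - (8 / 9 * G j + 1 / 500 * (1 - t)))) := by ring
        _ ≤ 9 * (1 - e) * G j := by
            apply mul_le_mul_of_nonneg_left ih
            linarith
        _ ≤ _ := hstep
  -- If `G K < 1 / 16`, the bracket is at least `1 - 1/18 - 1/500`, which with `9 ^ K * G 0 ≥
  -- 98/100` forces `G K > 9/10`.
  have hfin := key K le_rfl
  have hl := hlt K le_rfl
  have hhalf0 : (0 : ℝ) < (1 / 2) ^ K := by positivity
  have h9 : (98 / 100 : ℝ) ≤ 9 ^ K * G 0 := by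
    have : 98 / 100 * (9 ^ K * lam) ≤ 9 ^ K * G 0 := by
      have := mul_le_mul_of_nonneg_left h0 (show (0 : ℝ) ≤ 9 ^ K by positivity)
      linarith
    linarith
  nlinarith

theorem exists_checkedWeight_true_ge (hα : ∑ x, ‖α x‖ ^ 2 ≤ 1) (hq0 : ∀ j x, 0 ≤ q j x) {K : ℕ}
    (hs : ∀ j < K, ∑ x, ‖checkedAmp α q j x‖ ^ 2 ≤ 1)
    (hbad : ∀ j ≤ K, ∀ x, f x = false → q j x ≤ (1 / 100) ^ (j + 1))
    (hgood : ∀ j ≤ K, ∀ x, f x = true → 1 - (1 / 100) ^ (j + 1) ≤ q j x) {lam : ℝ}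
    (hlam : lam ≤ ∑ x, if f x = true then ‖α x‖ ^ 2 else 0) (hK : 1 ≤ 9 ^ K * lam) :
    ∃ k ≤ K, 1 / 16 ≤ checkedWeight α q f true k := by
  refine exists_large_of_growth (checkedWeight_nonneg α q f true) ?_ hK fun j hj hsmall =>
    checkedWeight_true_succ_ge hsmall (checkedWeight_false_le hα hq0 hs hbad j hj.le)
      fun x hx => hgood (j + 1) hj x hx
  calc 98 / 100 * lam ≤ 98 / 100 * ∑ x, (if f x = true then ‖α x‖ ^ 2 else 0) := by gcongr
    _ ≤ _ := by
      rw [checkedWeight, Finset.mul_sum]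
      refine Finset.sum_le_sum fun x _ => ?_
      split_ifs with hx
      · rw [checkedAmp, norm_mul, Complex.norm_real, mul_pow, Real.norm_eq_abs, sq_abs]
        gcongr
        have := hgood 0 (Nat.zero_le _) x hx
        norm_num at this
        nlinarith
      · simp

end AmplitudeGrowth

/-! ### Measuring all qubits and restarting -/

section Sampling

variable {n w N : ℕ} (A : QUnitary (Fin n)) (O : QUnitary (OracleWire n w))

theorem applyOn_smul {ι : Type} [Fintype ι] [DecidableEq ι] (e : ι ↪ Fin N) (U : QUnitary ι)
    (c : ℂ) (ψ : QState N) : applyOn e U (c • ψ) = c • applyOn e U ψ := by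
  rw [applyOn_eq_mulVec, applyOn_eq_mulVec, Matrix.mulVec_smul]

theorem project_smul (i : Fin N) (b : Bool) (c : ℂ) (ψ : QState N) :
    project i b (c • ψ) = c • project i b ψ := by
  funext z
  simp [project]

namespace QAlg

/-- Measurement branches are kept unnormalised; homogeneity turns the amplitude of a branch into a
probability factor. -/
theorem outProbFrom_smul (alg : QAlg n w N) (c : ℂ) (ψ : QState N)
    (out : Option (Bits (Fin n))) :
    alg.outProbFrom A O (c • ψ) out = ‖c‖ ^ 2 * alg.outProbFrom A O ψ out := by
  induction alg generalizing ψ with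
  | halt r =>
    simp only [outProbFrom]
    split_ifs
    · simp [Finset.mul_sum, mul_pow]
    · simp
  | gate U next ih => simp only [outProbFrom, Matrix.mulVec_smul, ih]
  | prep e next ih => simp only [outProbFrom, applyOn_smul, ih]
  | prepInv e next ih => simp only [outProbFrom, applyOn_smul, ih]
  | query e next ih => simp only [outProbFrom, applyOn_smul, ih]
  | queryInv e next ih => simp only [outProbFrom, applyOn_smul, ih]
  | measure i next ih => simp only [outProbFrom, project_smul, ih, mul_add]

theorem outProbFrom_zero (alg : QAlg n w N) (out : Option (Bits (Fin n))) :
    alg.outProbFrom A O 0 out = 0 := by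
  have h := outProbFrom_smul A O alg 0 0 out
  simpa using h

/-- Measure the qubits of a list; the results overwrite the entries of `acc`. -/
def measureList (next : Bits (Fin N) → QAlg n w N) : List (Fin N) → Bits (Fin N) → QAlg n w N
  | [], acc => next acc
  | i :: l, acc => measure i fun b => measureList next l (Function.update acc i b)

/-- `hψ` is the induction invariant: qubits outside `l` already have the values recorded in `acc`.
It is vacuous when `l` lists all qubits. -/
theorem outProbFrom_measureList (next : Bits (Fin N) → QAlg n w N) (l : List (Fin N))
    (acc : Bits (Fin N)) (ψ : QState N) (hψ : ∀ z, (∃ i ∉ l, z i ≠ acc i) → ψ z = 0)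
    (out : Option (Bits (Fin n))) :
    (measureList next l acc).outProbFrom A O ψ out =
      ∑ z, (next z).outProbFrom A O (ψ z • Pi.single z 1) out := by
  induction l generalizing acc ψ with
  | nil =>
    have h0 : ∀ z, z ≠ acc → ψ z = 0 := fun z hz => by
      obtain ⟨i, hi⟩ := Function.ne_iff.mp hz
      exact hψ z ⟨i, by simp, hi⟩
    rw [Finset.sum_eq_single acc]
    · rw [measureList]
      congr 1
      funext z
      by_cases hz : z = acc
      · simp [hz]
      · simp [hz, h0 z hz]
    · intro z _ hz
      rw [h0 z hz, zero_smul, outProbFrom_zero]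
    · simp
  | cons i l ih =>
    have hb : ∀ b, ∀ z, (∃ i' ∉ l, z i' ≠ Function.update acc i b i') →
        project i b ψ z = 0 := by
      rintro b z ⟨i', hi', hz⟩
      rw [project]
      split_ifs with hzi
      · have hne : i' ≠ i := by
          rintro rfl
          simp [hzi] at hz
        rw [Function.update_of_ne hne] at hz
        exact hψ z ⟨i', by simp [hne, hi'], hz⟩
      · rfl
    rw [measureList, outProbFrom, ih _ _ (hb false), ih _ _ (hb true), ← Finset.sum_add_distrib]
    refine Finset.sum_congr rfl fun z _ => ?_
    cases hz : z i <;> simp [project, hz, outProbFrom_zero]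

theorem queries_measureList_le (next : Bits (Fin N) → QAlg n w N) (l : List (Fin N))
    (acc : Bits (Fin N)) {b : ℕ} (hb : ∀ z, (next z).queries ≤ b) :
    (measureList next l acc).queries ≤ b := by
  induction l generalizing acc with
  | nil => exact hb acc
  | cons i l ih => exact max_le (ih _) (ih _)

end QAlg

theorem xorBits_involutive (y : Bits (Fin N)) :
    Function.Involutive fun (z : Bits (Fin N)) i => xor (z i) (y i) := by
  intro z
  funext i
  simp

/-- Flip the qubits that are set in `y`. -/
def xorGate (y : Bits (Fin N)) : QUnitary (Fin N) := involutionGate _ (xorBits_involutive y)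

theorem xorBits_eq_zero_iff (y z : Bits (Fin N)) :
    (fun i => xor (z i) (y i)) = zeroBits (Fin N) ↔ z = y := by
  constructor
  · intro h
    funext i
    simpa [zeroBits] using congrFun h i
  · rintro rfl
    funext i
    simp [zeroBits]

theorem xorGate_init (y : Bits (Fin N)) :
    (xorGate y).val.mulVec (initState N) = Pi.single y 1 := by
  funext z
  rw [xorGate, involutionGate_mulVec, initState]
  simp only [Pi.single_apply, xorBits_eq_zero_iff]

theorem xorGate_single (y : Bits (Fin N)) :
    (xorGate y).val.mulVec (Pi.single y 1) = initState N := by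
  funext z
  have h : (fun i => xor (z i) (y i)) = y ↔ z = zeroBits (Fin N) := by
    rw [(xorBits_involutive y).eq_iff, eq_comm]
    have : (fun i => xor (y i) (y i)) = zeroBits (Fin N) := by
      funext i
      simp [zeroBits]
    rw [this, eq_comm, eq_comm]
  rw [xorGate, involutionGate_mulVec, initState]
  simp only [Pi.single_apply, h]

namespace QAlg

/-- Run a circuit on cleared qubits, measure and clear all qubits, and continue as the result
says. -/
def sample (c : QCircuit n w N) (next : Bits (Fin N) → QAlg n w N) : QAlg n w N :=
  c.andThen (measureList (fun z => gate (xorGate z) (next z)) (List.finRange N) (zeroBits _))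

theorem outProb_sample (c : QCircuit n w N) (next : Bits (Fin N) → QAlg n w N)
    (out : Option (Bits (Fin n))) :
    (sample c next).outProb A O out =
      ∑ z, ‖c.run A O (initState N) z‖ ^ 2 * (next z).outProb A O out := by
  rw [sample, outProb, QCircuit.outProbFrom_andThen, outProbFrom_measureList]
  · refine Finset.sum_congr rfl fun z _ => ?_
    rw [outProbFrom_smul, outProbFrom, xorGate_single, outProb]
  · rintro z ⟨i, hi, -⟩
    exact absurd (List.mem_finRange i) hi

theorem queries_sample_le (c : QCircuit n w N) (next : Bits (Fin N) → QAlg n w N) {b : ℕ}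
    (hb : ∀ z, (next z).queries ≤ b) : (sample c next).queries ≤ c.cost + b := by
  rw [sample, QCircuit.queries_andThen]
  have := queries_measureList_le (fun z => gate (xorGate z) (next z)) (List.finRange N)
    (zeroBits _) hb
  omega

/-- The probability that the output is not accepted by `v`. -/
noncomputable def loss (v : Option (Bits (Fin n)) → Bool) (alg : QAlg n w N) : ℝ :=
  1 - ∑ out, if v out = true then alg.outProb A O out else 0

theorem loss_halt (v : Option (Bits (Fin n)) → Bool) (out : Option (Bits (Fin n))) :
    (halt out : QAlg n w N).loss A O v = if v out = true then 0 else 1 := by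
  have h1 : ∑ z, ‖initState N z‖ ^ 2 = 1 := by
    have := QCircuit.sum_norm_sq_run_init A O ([] : QCircuit n w N)
    simpa only [QCircuit.run_nil] using this
  simp only [loss, outProb, outProbFrom, h1]
  rw [Finset.sum_eq_single out]
  · split_ifs <;> simp_all
  · intro o _ ho
    simp [ho.symm]
  · simp

/-- The outcome probabilities sum to `1`, so losses average. From here on the analysis is that of a
classical random process. -/
theorem loss_sample (v : Option (Bits (Fin n)) → Bool) (c : QCircuit n w N)
    (next : Bits (Fin N) → QAlg n w N) :
    (sample c next).loss A O v =
      ∑ z, ‖c.run A O (initState N) z‖ ^ 2 * (next z).loss A O v := by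
  simp only [loss, mul_sub, mul_one, Finset.sum_sub_distrib, QCircuit.sum_norm_sq_run_init,
    Finset.mul_sum]
  rw [Finset.sum_comm]
  congr 1
  refine Finset.sum_congr rfl fun o _ => ?_
  split_ifs with h
  · rw [outProb_sample]
  · simp

end QAlg

end Sampling

/-! ### One attempt: all stages in turn -/

section Attempt

variable {n w r m N : ℕ} (σ : SearchWire n w r m ≃ Fin N)
variable (A : QUnitary (Fin n)) (O : QUnitary (OracleWire n w))

open QAlg

/-- Run the stages `K - 1`, …, `0` and measure, until one of them ends in its cleared sector. -/
noncomputable def attempt (τ : ℕ → Bits (Fin m)) (k : ℕ → ℕ) :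
    ℕ → (Option (Bits (Fin n)) → QAlg n w N) → QAlg n w N
  | 0, next => next none
  | K + 1, next => sample (stageCircuit σ τ k K) fun z =>
      if clearSector σ (τ (2 * K + 2)) z = true then next (some (inputPart σ z))
      else attempt τ k K next

theorem queries_attempt_le (τ : ℕ → Bits (Fin m)) (μ K : ℕ)
    (next : Option (Bits (Fin n)) → QAlg n w N) {b : ℕ} (hb : ∀ o, (next o).queries ≤ b) :
    (attempt σ τ (fun j => 2 * ((j + 1) * μ)) K next).queries ≤ 5 * μ * 3 ^ K + b := by
  induction K with
  | zero => exact (hb none).trans (Nat.le_add_left _ _)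
  | succ K ih =>
    have h := queries_sample_le (stageCircuit σ τ (fun j => 2 * ((j + 1) * μ)) K) (fun z =>
      if clearSector σ (τ (2 * K + 2)) z = true then next (some (inputPart σ z))
      else attempt σ τ (fun j => 2 * ((j + 1) * μ)) K next) (b := 5 * μ * 3 ^ K + b) (by
        intro z
        split_ifs
        · exact (hb _).trans (Nat.le_add_left _ _)
        · exact ih)
    have hc := cost_stageCircuit_le (σ := σ) τ μ K
    rw [attempt, pow_succ]
    nlinarith

variable {σ}

theorem sum_norm_sq_checkedAmp_le_one (σ : SearchWire n w r m ≃ Fin N)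
    (hO : PreservesInput O) {τ : ℕ → Bits (Fin m)} {M : ℕ}
    (hτ : Set.InjOn τ (Set.Iic M)) (hτ0 : τ 0 = zeroBits _) (k : ℕ → ℕ) (j : ℕ)
    (hj : 2 * j + 2 ≤ M) :
    ∑ x, ‖checkedAmp (amplitude A) (fun j => majorityProb O r (k j)) j x‖ ^ 2 ≤ 1 := by
  have h := norm_sq_run_stageCircuit (σ := σ) A O hO hτ hτ0 k j hj fun _ => 1
  simp only [mul_one] at h
  rw [← h]
  refine le_of_le_of_eq (Finset.sum_le_sum fun z _ => ?_)
    (QCircuit.sum_norm_sq_run_init A O (stageCircuit σ τ k j))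
  split_ifs <;> simp

theorem loss_attempt_succ (hO : PreservesInput O) {τ : ℕ → Bits (Fin m)} {M : ℕ}
    (hτ : Set.InjOn τ (Set.Iic M)) (hτ0 : τ 0 = zeroBits _) (k : ℕ → ℕ) (K : ℕ)
    (hK : 2 * K + 2 ≤ M) (next : Option (Bits (Fin n)) → QAlg n w N)
    (v : Option (Bits (Fin n)) → Bool) :
    (attempt σ τ k (K + 1) next).loss A O v =
      (∑ x, ‖checkedAmp (amplitude A) (fun j => majorityProb O r (k j)) K x‖ ^ 2 *
        (next (some x)).loss A O v) +
      (1 - ∑ x, ‖checkedAmp (amplitude A) (fun j => majorityProb O r (k j)) K x‖ ^ 2) *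
        (attempt σ τ k K next).loss A O v := by
  have h := norm_sq_run_stageCircuit (σ := σ) A O hO hτ hτ0 k K hK
  have h1 := h fun x => (next (some x)).loss A O v
  have h2 := h fun _ => 1
  simp only [mul_one] at h2
  have h3 : 1 - (∑ z, ‖(stageCircuit σ τ k K).run A O (initState N) z‖ ^ 2 *
      if clearSector σ (τ (2 * K + 2)) z = true then 1 else 0) =
      ∑ z, (‖(stageCircuit σ τ k K).run A O (initState N) z‖ ^ 2 -
        ‖(stageCircuit σ τ k K).run A O (initState N) z‖ ^ 2 *
          if clearSector σ (τ (2 * K + 2)) z = true then 1 else 0) := by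
    rw [Finset.sum_sub_distrib, QCircuit.sum_norm_sq_run_init]
  rw [attempt, loss_sample, ← h1, ← h2, h3, Finset.sum_mul, ← Finset.sum_add_distrib]
  refine Finset.sum_congr rfl fun z _ => ?_
  split_ifs <;> simp

/-- If a stage finds a good input with probability at least `1 / 16`, an attempt reduces the loss
accordingly. -/
theorem loss_attempt_le (hO : PreservesInput O) {τ : ℕ → Bits (Fin m)} {M : ℕ}
    (hτ : Set.InjOn τ (Set.Iic M)) (hτ0 : τ 0 = zeroBits _) (k : ℕ → ℕ)
    (next : Option (Bits (Fin n)) → QAlg n w N) (v : Option (Bits (Fin n)) → Bool)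
    (f : Bits (Fin n) → Bool) {lg lb ln : ℝ} (hgn : lg ≤ ln) (hnb : ln ≤ lb)
    (hnone : (next none).loss A O v ≤ ln)
    (hbad : ∀ x, f x = false → (next (some x)).loss A O v ≤ lb)
    (K : ℕ) (hK : 2 * K ≤ M)
    (hgood : ∀ x, f x = true → (next (some x)).loss A O v ≤ lg ∨
      ∀ j < K, checkedAmp (amplitude A) (fun j => majorityProb O r (k j)) j x = 0)
    (hB : ∀ j < K, checkedWeight (amplitude A) (fun j => majorityProb O r (k j)) f false j ≤
      1 / 10000 * (1 / 2) ^ j) :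
    (attempt σ τ k K next).loss A O v ≤ ln + (lb - lg) * (1 / 5000 * (1 - (1 / 2) ^ K)) ∧
    ((∃ j < K, 1 / 16 ≤ checkedWeight (amplitude A) (fun j => majorityProb O r (k j)) f true j) →
      (attempt σ τ k K next).loss A O v ≤
        ln + (lb - lg) * (1 / 5000 * (1 - (1 / 2) ^ K)) - (ln - lg) / 16) := by
  induction K with
  | zero => simpa [attempt] using hnone
  | succ K ih =>
    obtain ⟨ih1, ih2⟩ := ih (by omega)
      (fun x hx => (hgood x hx).imp_right fun h j hj => h j (by omega))
      (fun j hj => hB j (by omega))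
    set G := checkedWeight (amplitude A) (fun j => majorityProb O r (k j)) f true K with hGd
    set B := checkedWeight (amplitude A) (fun j => majorityProb O r (k j)) f false K with hBd
    have hBK : B ≤ 1 / 10000 * (1 / 2) ^ K := hB K (by omega)
    have hG0 : 0 ≤ G := checkedWeight_nonneg _ _ _ _ _
    have hB0 : 0 ≤ B := checkedWeight_nonneg _ _ _ _ _
    have hGB : G + B = ∑ x, ‖checkedAmp (amplitude A) (fun j => majorityProb O r (k j)) K x‖ ^ 2 :=
      checkedWeight_add _ _ _ _
    have hs := sum_norm_sq_checkedAmp_le_one A O σ hO hτ hτ0 k K (by omega)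
    rw [← hGB] at hs
    have hsum : (∑ x, ‖checkedAmp (amplitude A) (fun j => majorityProb O r (k j)) K x‖ ^ 2 *
        (next (some x)).loss A O v) ≤ G * lg + B * lb := by
      rw [hGd, hBd, checkedWeight, checkedWeight, Finset.sum_mul, Finset.sum_mul,
        ← Finset.sum_add_distrib]
      refine Finset.sum_le_sum fun x _ => ?_
      cases hx : f x
      · simp only [Bool.false_eq_true, if_false, if_true, zero_mul, zero_add]
        exact mul_le_mul_of_nonneg_left (hbad x hx) (by positivity)
      · rcases hgood x hx with h | h
        · simp only [Bool.true_eq_false, if_false, if_true, zero_mul, add_zero]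
          exact mul_le_mul_of_nonneg_left h (by positivity)
        · simp [h K (by omega)]
    rw [loss_attempt_succ A O hO hτ hτ0 k K (by omega), ← hGB]
    have hhalf : ((1 : ℝ) / 2) ^ K ≤ 1 := pow_le_one₀ (by norm_num) (by norm_num)
    set c := (attempt σ τ k K next).loss A O v
    set t : ℝ := (1 / 2) ^ K
    have ht : ((1 : ℝ) / 2) ^ (K + 1) = t / 2 := by rw [pow_succ]; ring
    rw [ht]
    have hd : 0 ≤ (lb - lg) * (1 / 5000 * (1 - t)) := by
      apply mul_nonneg <;> linarith
    -- `D` bounds the loss of the remaining stages. Ending here with a good input (weight `G`) saves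
    -- `D - lg`; ending with a bad one (weight `B`) costs at most `lb - lg`.
    have step : ∀ D, lg ≤ D → c ≤ D →
        G * lg + B * lb + (1 - (G + B)) * c ≤
          D + (lb - lg) * (1 / 10000 * t) - G * (D - lg) := by
      intro D hD hc
      have h1 : (1 - (G + B)) * c ≤ (1 - (G + B)) * D :=
        mul_le_mul_of_nonneg_left hc (by linarith)
      have h2 : B * (lb - D) ≤ B * (lb - lg) := mul_le_mul_of_nonneg_left (by linarith) hB0
      have h3 : B * (lb - lg) ≤ (1 / 10000 * t) * (lb - lg) :=
        mul_le_mul_of_nonneg_right hBK (by linarith)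
      linarith
    constructor
    · have := step _ (by linarith) ih1
      have h4 : 0 ≤ G * (ln + (lb - lg) * (1 / 5000 * (1 - t)) - lg) :=
        mul_nonneg hG0 (by linarith)
      linarith
    · rintro ⟨j, hj, hjG⟩
      rcases Nat.lt_succ_iff_lt_or_eq.mp hj with hj | rfl
      · have := step _ (by linarith) (ih2 ⟨j, hj, hjG⟩)
        have h4 : 0 ≤ G * (ln + (lb - lg) * (1 / 5000 * (1 - t)) - (ln - lg) / 16 - lg) :=
          mul_nonneg hG0 (by linarith)
        linarith
      · have := step _ (by linarith) ih1
        have h4 : 1 / 16 * (ln - lg) ≤ G * (ln + (lb - lg) * (1 / 5000 * (1 - t)) - lg) :=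
          mul_le_mul hjG (by linarith) (by linarith) hG0
        linarith

end Attempt

/-! ### The random walk on candidates -/

section Walk

open QAlg

variable {n w r m N : ℕ} (σ : SearchWire n w r m ≃ Fin N)
variable (A : QUnitary (Fin n)) (O : QUnitary (OracleWire n w))

/-- Take a majority vote of `k` oracle calls on `x` and continue as it says. -/
noncomputable def verify (k : ℕ) (x : Bits (Fin n)) (next : Bool → QAlg n w N) : QAlg n w N :=
  sample ([.gate (xorGate (basisState σ x clearRegs (zeroBits _)))] ++ votes σ k) fun z =>
    next (majority k (registerPart σ z))

theorem queries_verify_le (k : ℕ) (x : Bits (Fin n)) (next : Bool → QAlg n w N) {b : ℕ}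
    (hb : ∀ o, (next o).queries ≤ b) : (verify σ k x next).queries ≤ k + b := by
  refine (queries_sample_le _ _ fun z => hb _).trans ?_
  rw [QCircuit.cost_append]
  have h := cost_votes_le σ k
  have h' : QCircuit.cost [QOp.gate (n := n) (w := w)
    (xorGate (basisState σ x clearRegs (zeroBits _)))] = 0 := rfl
  omega

theorem loss_verify (hO : PreservesInput O) (k : ℕ) (x : Bits (Fin n))
    (next : Bool → QAlg n w N) (v : Option (Bits (Fin n)) → Bool) :
    (verify σ k x next).loss A O v = majorityProb O r k x * (next true).loss A O v +
      (1 - majorityProb O r k x) * (next false).loss A O v := by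
  have h := majorityProb_add (r := r) hO k x
  rw [← eq_sub_iff_add_eq'] at h
  rw [← h, majorityProb, verify, loss_sample, sum_basis σ, Finset.sum_eq_single x, Finset.sum_mul,
    Finset.sum_mul, ← Finset.sum_add_distrib]
  · refine Finset.sum_congr rfl fun g _ => ?_
    rw [Finset.sum_eq_single (zeroBits _)]
    · rw [QCircuit.run_append, QCircuit.run_singleton, QOp.unitary, xorGate_init,
        run_votes_single σ A O hO, registerPart_basisState]
      cases majority k g <;> simp [norm_prod, Finset.prod_pow]
    · intro t _ ht
      rw [QCircuit.run_append, QCircuit.run_singleton, QOp.unitary, xorGate_init,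
        run_votes_single σ A O hO]
      simp [ht]
    · simp
  · intro y _ hy
    refine Finset.sum_eq_zero fun g _ => Finset.sum_eq_zero fun t _ => ?_
    rw [QCircuit.run_append, QCircuit.run_singleton, QOp.unitary, xorGate_init,
      run_votes_single σ A O hO]
    simp [hy]
  · simp

/-- A random walk on candidates: at height `0` a candidate is looked for, otherwise the candidate
is verified and the height changes by one. After `t` steps the candidate is returned if the height
is at least `H`. -/
noncomputable def walk (τ : ℕ → Bits (Fin m)) (μ K H : ℕ) : ℕ → Bits (Fin n) → ℕ → QAlg n w N
  | 0, x, h => halt (if H ≤ h then some x else none)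
  | t + 1, _, 0 => attempt σ τ (fun j => 2 * ((j + 1) * μ)) (K + 1) fun o =>
      o.elim (walk τ μ K H t (zeroBits _) 0) fun y => walk τ μ K H t y 1
  | t + 1, x, h + 1 => verify σ (2 * μ) x fun b =>
      if b = true then walk τ μ K H t x (h + 2) else walk τ μ K H t x h

theorem queries_walk_le (τ : ℕ → Bits (Fin m)) (μ K H t : ℕ) (x : Bits (Fin n)) (h : ℕ) :
    (walk σ τ μ K H t x h).queries ≤ t * (15 * μ * 3 ^ K) := by
  induction t generalizing x h with
  | zero => simp [walk, queries]
  | succ t ih =>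
    have h3 : 1 ≤ 3 ^ K := Nat.one_le_pow _ _ (by norm_num)
    cases h with
    | zero =>
      rw [walk]
      refine (queries_attempt_le σ τ μ (K + 1) _ (b := t * (15 * μ * 3 ^ K)) ?_).trans ?_
      · rintro (_ | y)
        · exact ih _ _
        · exact ih _ _
      · rw [pow_succ]
        nlinarith
    | succ h =>
      rw [walk]
      refine (queries_verify_le σ (2 * μ) x _ (b := t * (15 * μ * 3 ^ K)) ?_).trans ?_
      · rintro (_ | _)
        · simpa using ih x h
        · simpa using ih x (h + 2)
      · nlinarith [Nat.mul_le_mul_left μ h3]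

section Analysis

variable {σ} {f : Bits (Fin n) → Bool} {O} {p : ℝ} (hO : IsBiasedOracle f p O) (hp : 1 / 2 < p)
  (hp1 : p < 1) {μ K : ℕ} (hr : 2 * ((K + 1) * μ) ≤ r) (hμ : (4 * p * (1 - p)) ^ μ ≤ 1 / 100)
  {τ : ℕ → Bits (Fin m)} (hτ : Set.InjOn τ (Set.Iic (2 * (K + 1)))) (hτ0 : τ 0 = zeroBits _)

include hO hp hp1 hr hμ in
theorem majorityProb_level_le {j : ℕ} (hj : j ≤ K) (x : Bits (Fin n)) (hx : f x = false) :
    majorityProb O r (2 * ((j + 1) * μ)) x ≤ (1 / 100) ^ (j + 1) := by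
  have hjK : (j + 1) * μ ≤ (K + 1) * μ := Nat.mul_le_mul_right _ (by omega)
  refine (hO.majorityProb_le hp hp1 (by omega) x hx).trans ?_
  rw [mul_comm (j + 1) μ, pow_mul]
  have : 0 ≤ 4 * p * (1 - p) := mul_nonneg (by linarith) (by linarith)
  gcongr

include hO hp hp1 hr hμ in
theorem le_majorityProb_level {j : ℕ} (hj : j ≤ K) (x : Bits (Fin n)) (hx : f x = true) :
    1 - (1 / 100) ^ (j + 1) ≤ majorityProb O r (2 * ((j + 1) * μ)) x := by
  have hjK : (j + 1) * μ ≤ (K + 1) * μ := Nat.mul_le_mul_right _ (by omega)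
  refine le_trans ?_ (hO.le_majorityProb hp hp1 (by omega) x hx)
  rw [mul_comm (j + 1) μ, pow_mul]
  have : 0 ≤ 4 * p * (1 - p) := mul_nonneg (by linarith) (by linarith)
  gcongr

theorem sum_norm_sq_amplitude : ∑ x, ‖amplitude A x‖ ^ 2 = 1 :=
  unitary_sum_norm_sq_col A (zeroBits _)

include σ hO hp hp1 hr hμ hτ hτ0 in
theorem checkedWeight_false_level_le (j : ℕ) (hj : j < K + 1) :
    checkedWeight (amplitude A) (fun j => majorityProb O r (2 * ((j + 1) * μ))) f false j ≤
      1 / 10000 * (1 / 2) ^ j :=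
  checkedWeight_false_le (K := K) (sum_norm_sq_amplitude A).le (fun _ _ => majorityProb_nonneg _ _)
    (fun j hj => sum_norm_sq_checkedAmp_le_one A O σ hO.preservesInput hτ hτ0
      (fun j => 2 * ((j + 1) * μ)) j (by omega))
    (fun j hj x hx => majorityProb_level_le hO hp hp1 hr hμ hj x hx) j (by omega)

include hO hp hp1 hr hμ hτ hτ0 in
/-- If good inputs have probability at least `lam`, the walk finds one. -/
theorem loss_walk_le_of_good {lam : ℝ} (hlam : lam ≤ goodProb f A) (hK : 1 ≤ 9 ^ K * lam) {H : ℕ}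
    (t : ℕ) (x : Bits (Fin n)) (h : ℕ) :
    (walk σ τ μ K H t x h).loss A O (fun o => o.elim false f) ≤
      2 ^ H * (98 / 100) ^ t * (if f x = true then (1 / 2) ^ h else 2 ^ h) := by
  induction t generalizing x h with
  | zero =>
    rw [walk, loss_halt]
    by_cases hh : H ≤ h
    · rw [if_pos hh]
      cases hx : f x
      · simp [hx]
        exact one_le_mul_of_one_le_of_one_le (one_le_pow₀ (by norm_num))
          (one_le_pow₀ (by norm_num))
      · simp [hx]
    · rw [if_neg hh]
      cases hx : f x
      · simp
        exact one_le_mul_of_one_le_of_one_le (one_le_pow₀ (by norm_num))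
          (one_le_pow₀ (by norm_num))
      · simp
        rw [← div_eq_mul_inv, one_le_div (by positivity)]
        exact pow_le_pow_right₀ (by norm_num) (by omega)
  | succ t ih =>
    set u : ℝ := 2 ^ H * (98 / 100) ^ t with hu
    have hu0 : 0 ≤ u := by positivity
    have hu' : (2 : ℝ) ^ H * (98 / 100) ^ (t + 1) = 98 / 100 * u := by rw [hu, pow_succ]; ring
    rw [hu']
    cases h with
    | zero =>
      rw [walk]
      -- The three values are the potentials of a good candidate at height `1`, a bad one at height
      -- `1`, and height `0`. The step works since `1 + (3/2)/5000 - 1/32 ≤ 98/100`.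
      have key := (loss_attempt_le (σ := σ) A O hO.preservesInput hτ hτ0 (fun j => 2 * ((j + 1) * μ))
        (fun o => o.elim (walk σ τ μ K H t (zeroBits _) 0) fun y => walk σ τ μ K H t y 1)
        (fun o => o.elim false f) f (lg := u / 2) (lb := 2 * u) (ln := u) (by linarith)
        (by linarith)
        (by simpa using ih (zeroBits _) 0)
        (fun y hy => by
          have := ih y 1
          simp only [hy, Bool.false_eq_true, if_false, pow_one] at this
          simp only [Option.elim_some]
          linarith)
        (K + 1) le_rfl
        (fun y hy => Or.inl (by
          have := ih y 1
          simp only [hy, if_true, pow_one] at this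
          simp only [Option.elim_some]
          linarith))
        (checkedWeight_false_level_le (σ := σ) A hO hp hp1 hr hμ hτ hτ0)).2
        (by
          obtain ⟨k, hk, hk'⟩ := exists_checkedWeight_true_ge (K := K) (f := f)
            (q := fun j => majorityProb O r (2 * ((j + 1) * μ)))
            (sum_norm_sq_amplitude A).le (fun _ _ => majorityProb_nonneg _ _)
            (fun j hj => sum_norm_sq_checkedAmp_le_one A O σ hO.preservesInput hτ hτ0
              (fun j => 2 * ((j + 1) * μ)) j (by omega))
            (fun j hj x hx => majorityProb_level_le hO hp hp1 hr hμ hj x hx)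
            (fun j hj x hx => le_majorityProb_level hO hp hp1 hr hμ hj x hx) hlam hK
          exact ⟨k, by omega, hk'⟩)
      refine key.trans ?_
      have hhalf : (0 : ℝ) < (1 / 2) ^ (K + 1) := by positivity
      simp only [pow_zero, ite_self, mul_one]
      nlinarith
    | succ h =>
      rw [walk, loss_verify σ A O hO.preservesInput]
      simp only [if_true, Bool.false_eq_true, if_false]
      have hq0 : 0 ≤ majorityProb O r (2 * μ) x := majorityProb_nonneg _ _
      have hq1 : majorityProb O r (2 * μ) x ≤ 1 := majorityProb_le_one hO.preservesInput _ _
      have i1 := mul_le_mul_of_nonneg_left (ih x (h + 2)) hq0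
      have i2 := mul_le_mul_of_nonneg_left (ih x h) (sub_nonneg.mpr hq1)
      refine (add_le_add i1 i2).trans ?_
      -- With a positive vote of probability `q`, a bad candidate has factor `1 + 3q ≤ 1.03`,
      -- against the allowed `1.96`; a good one has `1 - 3q/4 ≤ 0.26`, against `0.49`.
      cases hx : f x
      · have hq := majorityProb_level_le hO hp hp1 hr hμ (Nat.zero_le _) x hx
        simp only [zero_add, one_mul, pow_one] at hq
        simp only [Bool.false_eq_true, if_false, pow_succ]
        have hy : 0 ≤ u * 2 ^ h := by positivity
        nlinarith
      · have hq := le_majorityProb_level hO hp hp1 hr hμ (Nat.zero_le _) x hx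
        simp only [zero_add, one_mul, pow_one] at hq
        simp only [if_true, pow_succ]
        have hy : 0 ≤ u * (1 / 2) ^ h := by positivity
        nlinarith

include hO hp hp1 hr hμ hτ hτ0 in
/-- If good inputs do not occur, the walk returns no input. -/
theorem loss_walk_le_of_no_good (hA : ∀ x, f x = true → amplitude A x = 0) {H : ℕ}
    (t : ℕ) (x : Bits (Fin n)) (h : ℕ) (hx : f x = false ∨ h = 0) :
    (walk σ τ μ K H t x h).loss A O (fun o => o.isNone) ≤
      (1 / 2) ^ H * ((2 / 3) ^ t * 2 ^ h + 3 * (1 - (2 / 3) ^ t)) := by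
  induction t generalizing x h with
  | zero =>
    rw [walk, loss_halt]
    by_cases hh : H ≤ h
    · simp [hh]
      rw [← div_eq_inv_mul, one_le_div (by positivity)]
      exact pow_le_pow_right₀ (by norm_num) hh
    · simp [hh]
  | succ t ih =>
    set u : ℝ := (1 / 2) ^ H with hu
    have hu0 : 0 ≤ u := by positivity
    have hs : ((2 : ℝ) / 3) ^ (t + 1) = (2 / 3) ^ t * (2 / 3) := pow_succ _ _
    rw [hs]
    set s : ℝ := (2 / 3) ^ t
    have hs0 : 0 ≤ s := by positivity
    have hus : 0 ≤ u * s := by positivity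
    cases h with
    | zero =>
      rw [walk]
      have hzero : ∀ y, f y = true → ∀ j,
          checkedAmp (amplitude A) (fun j => majorityProb O r (2 * ((j + 1) * μ))) j y = 0 := by
        intro y hy j
        induction j with
        | zero => simp [checkedAmp, hA y hy]
        | succ j ihj => rw [checkedAmp, ihj, mul_zero, mul_zero]
      have key := (loss_attempt_le (σ := σ) A O hO.preservesInput hτ hτ0 (fun j => 2 * ((j + 1) * μ))
        (fun o => o.elim (walk σ τ μ K H t (zeroBits _) 0) fun y => walk σ τ μ K H t y 1)
        (fun o => o.isNone) f (lg := u * (s + 3 * (1 - s))) (lb := u * (s * 2 + 3 * (1 - s)))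
        (ln := u * (s + 3 * (1 - s))) le_rfl
        (by nlinarith)
        (by simpa using ih (zeroBits _) 0 (Or.inr rfl))
        (fun y hy => by simpa using ih y 1 (Or.inl hy))
        (K + 1) le_rfl
        (fun y hy => Or.inr fun j _ => hzero y hy j)
        (checkedWeight_false_level_le (σ := σ) A hO hp hp1 hr hμ hτ hτ0)).1
      refine key.trans ?_
      have hhalf : (0 : ℝ) < (1 / 2) ^ (K + 1) := by positivity
      simp only [pow_zero, mul_one]
      nlinarith
    | succ h =>
      have hx : f x = false := hx.resolve_right (by omega)
      rw [walk, loss_verify σ A O hO.preservesInput]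
      simp only [if_true, Bool.false_eq_true, if_false]
      have hq0 : 0 ≤ majorityProb O r (2 * μ) x := majorityProb_nonneg _ _
      have hq1 : majorityProb O r (2 * μ) x ≤ 1 := majorityProb_le_one hO.preservesInput _ _
      have i1 := mul_le_mul_of_nonneg_left (ih x (h + 2) (Or.inl hx)) hq0
      have i2 := mul_le_mul_of_nonneg_left (ih x h (Or.inl hx)) (sub_nonneg.mpr hq1)
      refine (add_le_add i1 i2).trans ?_
      have hq := majorityProb_level_le hO hp hp1 hr hμ (Nat.zero_le _) x hx
      simp only [zero_add, one_mul, pow_one] at hq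
      simp only [pow_succ]
      set q := majorityProb O r (2 * μ) x
      have hy : 0 ≤ u * s * 2 ^ h := by positivity
      have e : q * (u * (s * (2 ^ h * 2 * 2) + 3 * (1 - s))) +
          (1 - q) * (u * (s * 2 ^ h + 3 * (1 - s))) =
          (1 + 3 * q) * (u * s * 2 ^ h) + u * (3 * (1 - s)) := by ring
      rw [e]
      nlinarith

end Analysis

end Walk

/-! ### Choice of the numerical parameters -/

section Parameters

/-- Unary numbers: the first `i` bits are set. -/
def unaryBits (m i : ℕ) : Bits (Fin m) := fun b => decide (b.val < i)

theorem unaryBits_zero (m : ℕ) : unaryBits m 0 = zeroBits _ := by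
  funext b
  simp [unaryBits, zeroBits]

theorem unaryBits_injOn (m : ℕ) : Set.InjOn (unaryBits m) (Set.Iic m) := by
  have key : ∀ i j, j ≤ m → i < j → unaryBits m i ≠ unaryBits m j := by
    intro i j hj hij h
    have := congrFun h ⟨i, by omega⟩
    simp [unaryBits] at this
    omega
  intro i hi j hj h
  rcases lt_trichotomy i j with hij | hij | hij
  · exact absurd h (key i j hj hij)
  · exact hij
  · exact absurd h.symm (key j i hi hij)

/-- From `4p(1-p) = 1 - 4(p-1/2)² ≤ exp(-4(p-1/2)²)`, rounding `2/(p-1/2)²` up brings the error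
below `exp(-8) ≤ 2^(-8)`. -/
theorem exists_vote_unit {p : ℝ} (hp : 1 / 2 < p) (hp1 : p < 1) :
    ∃ μ : ℕ, 1 ≤ μ ∧ (4 * p * (1 - p)) ^ μ ≤ 1 / 100 ∧ (μ : ℝ) ≤ 3 / (p - 1 / 2) ^ 2 := by
  have hγ : 0 < (p - 1 / 2) ^ 2 := by
    have : 0 < p - 1 / 2 := by linarith
    positivity
  have hγ1 : 1 ≤ 1 / (p - 1 / 2) ^ 2 := by
    rw [one_le_div hγ]
    nlinarith
  set y := 1 / (p - 1 / 2) ^ 2 with hy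
  have hceil : 2 * y ≤ (⌈2 * y⌉₊ : ℝ) := Nat.le_ceil _
  refine ⟨⌈2 * y⌉₊, ?_, ?_, ?_⟩
  · exact Nat.one_le_ceil_iff.mpr (by linarith)
  · have h1 : 4 * p * (1 - p) ≤ Real.exp (-(4 * (p - 1 / 2) ^ 2)) := by
      have := Real.add_one_le_exp (-(4 * (p - 1 / 2) ^ 2))
      nlinarith
    have h0 : 0 ≤ 4 * p * (1 - p) := mul_nonneg (by linarith) (by linarith)
    have h8 : 4 * (p - 1 / 2) ^ 2 * (2 * y) = 8 := by
      have := mul_one_div_cancel hγ.ne'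
      rw [← hy] at this
      linarith
    calc (4 * p * (1 - p)) ^ ⌈2 * y⌉₊ ≤ Real.exp (-(4 * (p - 1 / 2) ^ 2)) ^ ⌈2 * y⌉₊ := by gcongr
      _ = Real.exp (-(4 * (p - 1 / 2) ^ 2 * ⌈2 * y⌉₊)) := by
        rw [← Real.exp_nat_mul]
        congr 1
        ring
      _ ≤ Real.exp (-8) := by
        gcongr
        rw [← h8]
        gcongr
      _ ≤ 1 / 100 := by
        have h2 : (2 : ℝ) ≤ Real.exp 1 := by
          have := Real.add_one_le_exp (1 : ℝ)
          linarith
        have h3 : (2 : ℝ) ^ 8 ≤ Real.exp 8 := by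
          calc (2 : ℝ) ^ 8 ≤ Real.exp 1 ^ 8 := by gcongr
            _ = Real.exp 8 := by rw [← Real.exp_nat_mul]; norm_num
        rw [Real.exp_neg, one_div]
        gcongr
        linarith
  · have := Nat.ceil_lt_add_one (show 0 ≤ 2 * y by linarith)
    rw [show 3 / (p - 1 / 2) ^ 2 = 3 * y by rw [hy]; ring]
    linarith

/-- The least `K` with `3^K > 1/√lam`; rounding up to a power of `3` costs the factor `3`. -/
theorem exists_stage_count {lam : ℝ} (h0 : 0 < lam) (h1 : lam ≤ 1) :
    ∃ K : ℕ, 1 ≤ 9 ^ K * lam ∧ (3 : ℝ) ^ K ≤ 3 / √lam ∧ (K : ℝ) ≤ Real.log (1 / lam) + 1 := by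
  have hs : 0 < √lam := Real.sqrt_pos.mpr h0
  have hs1 : √lam ≤ 1 := Real.sqrt_le_one.mpr h1
  obtain ⟨k, hk1, hk2⟩ := exists_nat_pow_near (x := 1 / √lam) (y := 3)
    ((one_le_div hs).mpr hs1) (by norm_num)
  refine ⟨k + 1, ?_, ?_, ?_⟩
  · rw [div_lt_iff₀ hs] at hk2
    have h9 : (9 : ℝ) ^ (k + 1) * lam = (3 ^ (k + 1) * √lam) ^ 2 := by
      rw [mul_pow, Real.sq_sqrt h0.le, ← pow_mul, mul_comm (k + 1) 2, pow_mul]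
      norm_num
    rw [h9]
    exact one_le_pow₀ hk2.le
  · rw [pow_succ]
    calc (3 : ℝ) ^ k * 3 ≤ 1 / √lam * 3 := by gcongr
      _ = 3 / √lam := by ring
  · have hlog := Real.log_le_log (by positivity) hk1
    rw [Real.log_pow, one_div, Real.log_inv, Real.log_sqrt h0.le] at hlog
    have h3 : 1 ≤ Real.log 3 := by
      rw [Real.le_log_iff_exp_le (by norm_num)]
      linarith [Real.exp_one_lt_d9]
    have hl : Real.log lam ≤ 0 := Real.log_nonpos h0.le h1
    rw [one_div, Real.log_inv]
    push_cast
    nlinarith [Nat.cast_nonneg (α := ℝ) k]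

theorem exists_threshold {δ : ℝ} (h0 : 0 < δ) (h1 : δ ≤ 1 / 2) :
    ∃ H : ℕ, (1 / 2 : ℝ) ^ H * 3 ≤ δ ∧ (H : ℝ) ≤ 7 * Real.log (1 / δ) := by
  have hx : 1 ≤ 3 / δ := by
    rw [one_le_div h0]
    linarith
  obtain ⟨k, hk1, hk2⟩ := exists_nat_pow_near hx (show (1 : ℝ) < 2 by norm_num)
  refine ⟨k + 1, ?_, ?_⟩
  · rw [div_lt_iff₀ h0] at hk2
    rw [one_div, inv_pow, ← div_eq_inv_mul, div_le_iff₀ (by positivity)]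
    linarith
  · have hlog := Real.log_le_log (by positivity) hk1
    rw [Real.log_pow, Real.log_div (by norm_num) h0.ne'] at hlog
    have h2 := Real.log_two_gt_d9
    have h3 : Real.log 3 ≤ 2 * Real.log 2 := by
      rw [← Real.log_rpow (by norm_num)]
      exact Real.log_le_log (by norm_num) (by norm_num)
    have hδ : Real.log 2 ≤ Real.log (1 / δ) :=
      Real.log_le_log (by norm_num) (by rw [le_div_iff₀ h0]; linarith)
    have hneg : Real.log (1 / δ) = -Real.log δ := by rw [one_div, Real.log_inv]
    push_cast
    nlinarith [Nat.cast_nonneg (α := ℝ) k]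

end Parameters

/-! ### Assembling the theorem -/

namespace QAlg

variable {n w N : ℕ} (A : QUnitary (Fin n)) (O : QUnitary (OracleWire n w))

theorem goodOutProb_eq (alg : QAlg n w N) (f : Bits (Fin n) → Bool) :
    alg.goodOutProb f A O = 1 - alg.loss A O fun o => o.elim false f := by
  rw [loss, sub_sub_cancel, Fintype.sum_option]
  simp only [Option.elim_none, Bool.false_eq_true, if_false, zero_add]
  rfl

theorem outProb_none_eq (alg : QAlg n w N) :
    alg.outProb A O none = 1 - alg.loss A O fun o => o.isNone := by
  rw [loss, sub_sub_cancel, Fintype.sum_option]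
  simp

end QAlg

theorem mainTheorem3 :
    ∃ C : ℝ, 0 < C ∧
      ∀ (n w : ℕ) (p lam δ : ℝ), 1 / 2 < p → p < 1 → 0 < lam → lam ≤ 1 → 0 < δ → δ ≤ 1 / 2 →
        ∃ (a : ℕ) (alg : QAlg n w (n + a)),
          (a : ℝ) ≤ C * ((w + 1) * (2 * p / (p - 1 / 2) ^ 2) * Real.log (1 / (lam * δ))) ∧
          (alg.queries : ℝ) ≤
            C * (p / ((p - 1 / 2) ^ 2 * Real.sqrt lam) * Real.log (1 / (lam * δ))) ∧
          ∀ (f : Bits (Fin n) → Bool) (A : QUnitary (Fin n)) (O : QUnitary (OracleWire n w)),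
            IsBiasedOracle f p O →
              (lam ≤ goodProb f A → 1 - δ ≤ alg.goodOutProb f A O) ∧
              ((∀ x, f x = true → amplitude A x = 0) → 1 - δ ≤ alg.outProb A O none) := by
  refine ⟨200000, by norm_num, fun n w p lam δ hp hp1 hl0 hl1 hδ0 hδ1 => ?_⟩
  obtain ⟨μ, hμ1, hμ, hμle⟩ := exists_vote_unit hp hp1
  obtain ⟨K, hK, hK3, hKle⟩ := exists_stage_count hl0 hl1
  obtain ⟨H, hH, hHle⟩ := exists_threshold hδ0 hδ1
  -- As many registers as the longest vote needs, reused by all checks; `m` unary tag qubits provide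
  -- the tags `0, …, 2K+2` of rounds `0, …, K`.
  set r := 2 * ((K + 1) * μ) with hr
  set m := 2 * (K + 1) with hm
  have hcard : Fintype.card (SearchWire n w r m) = n + (r * (w + 1) + m) := by
    simp [SearchWire]
  let σ : SearchWire n w r m ≃ Fin (n + (r * (w + 1) + m)) := Fintype.equivFinOfCardEq hcard
  have hγ : 0 < (p - 1 / 2) ^ 2 := by
    have : 0 < p - 1 / 2 := by linarith
    positivity
  have hs : 0 < √lam := Real.sqrt_pos.mpr hl0
  have hL : Real.log (1 / (lam * δ)) = Real.log (1 / lam) + Real.log (1 / δ) := by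
    rw [← Real.log_mul (by positivity) (by positivity)]
    congr 1
    field_simp
  have hll : 0 ≤ Real.log (1 / lam) := Real.log_nonneg ((one_le_div hl0).mpr hl1)
  have hld : Real.log 2 ≤ Real.log (1 / δ) :=
    Real.log_le_log (by norm_num) (by rw [le_div_iff₀ hδ0]; linarith)
  have hlog2 := Real.log_two_gt_d9
  refine ⟨r * (w + 1) + m, walk σ (unaryBits m) μ K H (100 * H) (zeroBits _) 0, ?_, ?_, ?_⟩
  · set L := Real.log (1 / (lam * δ)) with hLd
    have hK4 : (K : ℝ) + 1 ≤ 3 * L := by linarith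
    have hμ1' : (1 : ℝ) ≤ μ := by exact_mod_cast hμ1
    have hw : (0 : ℝ) ≤ w := Nat.cast_nonneg w
    have hL0 : 0 ≤ L := by linarith
    rw [hr, hm]
    push_cast
    calc 2 * (((K : ℝ) + 1) * μ) * (w + 1) + 2 * (K + 1)
        ≤ 4 * ((K + 1) * μ * (w + 1)) := by
          have : 1 ≤ (μ : ℝ) * (w + 1) := one_le_mul_of_one_le_of_one_le hμ1' (by linarith)
          nlinarith [mul_le_mul_of_nonneg_left this (show (0 : ℝ) ≤ 2 * (K + 1) by positivity)]
      _ ≤ 4 * ((3 * L) * (3 / (p - 1 / 2) ^ 2) * (w + 1)) := by gcongr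
      _ = 36 * ((w + 1) * (1 / (p - 1 / 2) ^ 2) * L) := by ring
      _ ≤ 200000 * ((w + 1) * (2 * p / (p - 1 / 2) ^ 2) * L) := by
          gcongr
          · norm_num
          · linarith
  · set L := Real.log (1 / (lam * δ)) with hLd
    have hL0 : 0 ≤ L := by linarith
    have hHL : (H : ℝ) ≤ 7 * L := by linarith
    have hq := queries_walk_le σ (unaryBits m) μ K H (100 * H) (zeroBits _) 0
    calc ((walk σ (unaryBits m) μ K H (100 * H) (zeroBits _) 0).queries : ℝ)
        ≤ ((100 * H * (15 * μ * 3 ^ K) : ℕ) : ℝ) := by exact_mod_cast hq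
      _ = 1500 * (H * μ * 3 ^ K) := by push_cast; ring
      _ ≤ 1500 * ((7 * L) * (3 / (p - 1 / 2) ^ 2) * (3 / √lam)) := by gcongr
      -- The constant is `1500 * 7 * 3 * 3 = 94500 = 200000 * (189/400)`, and `189/400 < 1/2 < p`
      -- brings in the factor `p`.
      _ = 200000 * (189 / 400 / ((p - 1 / 2) ^ 2 * √lam) * L) := by
          field_simp
          ring
      _ ≤ _ := by
          gcongr
          linarith
  · intro f A O hO
    have hδH : (1 / 2 : ℝ) ^ H ≤ δ := by
      have : (0 : ℝ) < (1 / 2) ^ H := by positivity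
      linarith
    constructor
    · intro hlam
      have h := loss_walk_le_of_good (σ := σ) A hO hp hp1 le_rfl hμ (unaryBits_injOn m)
        (unaryBits_zero m) hlam hK (H := H) (100 * H) (zeroBits _) 0
      rw [QAlg.goodOutProb_eq]
      simp only [pow_zero, ite_self, mul_one] at h
      -- `100` steps per unit of height are enough because `2 * (98/100)^100 ≤ 1/2`.
      have h' : (2 : ℝ) ^ H * (98 / 100) ^ (100 * H) ≤ (1 / 2) ^ H := by
        rw [pow_mul, ← mul_pow]
        gcongr
        norm_num
      linarith
    · intro hA
      have h := loss_walk_le_of_no_good (σ := σ) A hO hp hp1 le_rfl hμ (unaryBits_injOn m)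
        (unaryBits_zero m) hA (H := H) (100 * H) (zeroBits _) 0 (Or.inr rfl)
      rw [QAlg.outProb_none_eq]
      have h' : (1 / 2 : ℝ) ^ H * ((2 / 3) ^ (100 * H) * 2 ^ 0 + 3 * (1 - (2 / 3) ^ (100 * H))) ≤
          (1 / 2) ^ H * 3 := by
        gcongr
        have : (0 : ℝ) ≤ (2 / 3) ^ (100 * H) := by positivity
        rw [pow_zero]
        linarith
      linarith
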